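/- **Setting.** Let $(\Omega,d)$ be a metric space; $B(x,r)$ and $\bar B(x,r)$ are the open and closed balls. A *field of dilatations* $\delta$ on $\Omega$ consists of open neighbourhoods $U(x)$, $V_\varepsilon(x)$ $(0<\varepsilon\le 1)$, $W_\varepsilon(x)$ $(\varepsilon>1)$ of each $x\in\Omega$ and of homeomorphisms $\delta^x_\varepsilon:U(x)\to V_\varepsilon(x)$ for $0<\varepsilon\le1$ and $\delta^x_\varepsilon:W_\varepsilon(x)\to U(x)$ for $\varepsilon>1$. Where they make sense, put $$\Delta^x_\varepsilon(u,v)=\delta^{\delta^x_\varepsilon u}_{\varepsilon^{-1}}\,\delta^x_\varepsilon v,\qquad \Sigma^x_\varepsilon(u,v)=\delta^x_{\varepsilon^{-1}}\,\delta^{\delta^x_\varepsilon u}_\varepsilon v .$$ Axioms: * **A0.** There are $1<A<B$ such that for all $x$ and $\varepsilon\in(0,1)$: $B(x,A)\subset U(x)$ and $B(x,\varepsilon)\subset\delta^x_\varepsilon B(x,A)\subset V_\varepsilon(x)\subset W_{\varepsilon^{-1}}(x)\subset\delta^x_\varepsilon(B(x,B)\cap U(x))$. For every compact $K$ there are $R>0$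 and $\varepsilon_0\in(0,1)$ such that $\delta^x_\varepsilon v\in W_{\varepsilon^{-1}}(\delta^x_\varepsilon u)$ for all $x\in K$, $u,v\in\bar B(x,R)$, $\varepsilon\in(0,\varepsilon_0)$. * **A1.** $\delta^x_\varepsilon x=x$ and $\delta^x_1=\mathrm{id}$ on $U(x)$. The map $(\varepsilon,x,y)\mapsto\delta^x_\varepsilon y$ is continuous on its domain $\{(\varepsilon,x,y): \varepsilon>0,\ y\in U(x)\text{ if }\varepsilon\le1,\ y\in W_\varepsilon(x)\text{ if }\varepsilon>1\}$ and extends continuously to the closure of this domain in $[0,\infty)\times\Omega\times\Omega$, with value $x$ at the points $(0,x,y)$. * **A2.** $\delta^x_\varepsilon\delta^x_\mu u=\delta^x_{\varepsilon\mu}u$ for $\varepsilon,\mu>0$ and $u\in U(x)$, whenever both sides are defined. * **A3.** For $A$ as in A0, $\bar B(x,A)\subset U(x)$ for every $x$, and there are distance functions $d^x$ on $\bar B(x,A)$ such that $\sup\{|\tfrac1\varepsilon d(\delta^x_\varepsilon u,\delta^x_\varepsilon v)-d^x(u,v)|:u,v\in\bar B(x,A)\}\to0$ as $\varepsilon\to0$,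 uniformly for $x$ in compact sets. * **A4.** For every compact $K$ there is $R>0$ such that for small $\varepsilon$ the points $\Delta^x_\varepsilon(u,v)$ are defined for $x\in K$, $u,v\in\bar B(x,R)$, and converge, uniformly in these $(x,u,v)$, to a limit $\Delta^x(u,v)$ as $\varepsilon\to0$. * **A4+.** A4 holds, and it also holds with $\Sigma^x_\varepsilon$ (limit $\Sigma^x$) in place of $\Delta^x_\varepsilon$. $(\Omega,d,\delta)$ is a *strong dilatation structure* if $(\Omega,d)$ is complete, all balls $\bar B(x,3)$ are compact, and A0–A4 hold. The length $l_d(c)$ of a curve $c$ is its variation with respect to $d$, and $\mathrm{Lip}(c)$ is its least Lipschitz constant. A strong dilatation structure is *tempered* if (a) $d$ is a length distance: $d(x,y)$ is the infimum of $l_d(c)$ over the Lipschitz curves $c$ from $x$ to $y$, and such curves exist for all $x,y$; and (b) for every compact $K$ there are $0<c<C$ and $\rho>0$ such that for all $\varepsilon\in(0,1]$ and all $x,u,v\in K$ at mutual distances at most $\rho$ $$c\,d^x(u,v)\le\tfrac1\varepsilon d(\delta^x_\varepsilon u,\delta^x_\varepsilon v)\le C\,d^x(u,v).$$ It has the *Radon–Nikodym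 property* if every Lipschitz curve $c:[a,b]\to\Omega$ is derivable at almost every $t\in(a,b)$, i.e. there are $r>0$ and $f:(-r,r)\to U(c(t))$ with $f(s+s')=\lim_{\varepsilon\to0}\Sigma^{c(t)}_\varepsilon(f(s),f(s'))$ whenever $s,s',s+s'\in(-r,r)$, with $f(\varepsilon s)=\delta^{c(t)}_\varepsilon f(s)$ for $0<\varepsilon\le1$, and with $\frac1\varepsilon d\big(c(t+\varepsilon s),\delta^{c(t)}_\varepsilon f(s)\big)\to0$ as $\varepsilon\to0$, uniformly in $s\in(-r,r)$. For $\varepsilon\in(0,1)$ let $\mathcal L_\varepsilon$ be the set of pairs $(x,c)\in\Omega\times C([0,1],\Omega)$ such that $c([0,1])\subset U(x)$, $\delta^x_\varepsilon c$ is Lipschitz and $\mathrm{Lip}(\delta^x_\varepsilon c)\le 2\,l_d(\delta^x_\varepsilon c)$, and put $l_\varepsilon(x,c)=\frac1\varepsilon l_d(\delta^x_\varepsilon c)$. Give $\Omega\times C([0,1],\Omega)$ the distance $\max\{d(x,x'),\sup_t d(c(t),c'(t))\}$. Let $\mathcal L$ be the set of pairs $(x,c)$ with $c([0,1])\subset U(x)$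 which are limits of pairs $(x_n,c_n)\in\mathcal L_{\varepsilon_n}$ with $\varepsilon_n\in(0,1)$, $\varepsilon_n\to0$ and $(c_n)$ equicontinuous. * **A3L.** There is a functional $l:\mathcal L\to[0,\infty]$ such that for every sequence $\varepsilon_n\in(0,1)$ with $\varepsilon_n\to0$ the functionals $l_{\varepsilon_n}$ Gamma-converge to $l$: (i) $l(z)\le\liminf_n l_{\varepsilon_n}(z_n)$ whenever $z_n\in\mathcal L_{\varepsilon_n}$ and $z_n\to z\in\mathcal L$; (ii) for every $z\in\mathcal L$ there are $z_n\in\mathcal L_{\varepsilon_n}$ with $z_n\to z$ and $l_{\varepsilon_n}(z_n)\to l(z)$. $(\Omega,d,\delta)$ is a *length dilatation structure* if $(\Omega,d)$ is complete and locally compact and A0, A1, A2, A3L and A4+ hold. **Corollary 8.4.** Every strong dilatation structure $(\Omega,d,\delta)$ which is tempered and has the Radon–Nikodym property is a length dilatation structure. -/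

import Mathlib

open Set Filter Topology Metric MeasureTheory
open scoped NNReal ENNReal unitInterval

/-- The data of a field of dilatations on `X`: for every point `x` the chart domain `U x`, the sets
`V ε x` (used for `0 < ε ≤ 1`) and `W ε x` (used for `1 < ε`), and the dilatation `δ ε x` of
coefficient `ε` based at `x`.  The map `δ ε x` is a total function, but only its values on
`U x` (if `ε ≤ 1`), respectively on `W ε x` (if `1 < ε`), are meaningful. -/
structure DilatationField (X : Type*) where
  U : X → Set X
  V : ℝ → X → Set X
  W : ℝ → X → Set X
  δ : ℝ → X → X → X

/-- The length of a curve parametrized by `[0,1]`: its variation. -/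
noncomputable def curveLength {X : Type*} [MetricSpace X] (c : I → X) : ℝ≥0∞ :=
  eVariationOn c univ

/-- The distance of `X` is a length distance: it is the infimum of the lengths of the Lipschitz
curves joining two points.  (The infimum over the empty family is `∞`, so the equality contains the
fact that any two points are joined by a Lipschitz curve.) -/
def IsLengthDistance (X : Type*) [MetricSpace X] : Prop :=
  ∀ x y : X, edist x y =
    ⨅ (c : I → X) (_ : (∃ K : ℝ≥0, LipschitzWith K c) ∧ c 0 = x ∧ c 1 = y), curveLength c

/-- Gamma-convergence of a sequence of functionals `F n`, defined on `S n ⊆ Z`, to a functional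
`F₀`, defined on `S₀ ⊆ Z`. -/
def GammaConverges {Z : Type*} [TopologicalSpace Z] (S : ℕ → Set Z) (F : ℕ → Z → ℝ≥0∞)
    (S₀ : Set Z) (F₀ : Z → ℝ≥0∞) : Prop :=
  (∀ (z : ℕ → Z) (z₀ : Z), (∀ n, z n ∈ S n) → z₀ ∈ S₀ → Tendsto z atTop (𝓝 z₀) →
    F₀ z₀ ≤ liminf (fun n => F n (z n)) atTop) ∧
  (∀ z₀ ∈ S₀, ∃ z : ℕ → Z, (∀ n, z n ∈ S n) ∧ Tendsto z atTop (𝓝 z₀) ∧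
    Tendsto (fun n => F n (z n)) atTop (𝓝 (F₀ z₀)))

namespace DilatationField

variable {X : Type*} [MetricSpace X] (D : DilatationField X)

open scoped Classical in
/-- The domain of definition of `δ ε x`. -/
noncomputable def domAt (ε : ℝ) (x : X) : Set X :=
  if ε ≤ 1 then D.U x else D.W ε x

/-- The total domain of `δ`, as a set of triples `(ε, x, y)`. -/
def dom : Set (ℝ × X × X) :=
  {p | 0 < p.1 ∧ p.2.2 ∈ D.domAt p.1 p.2.1}

/-- The sets `U x`, `V ε x`, `W ε x` are open neighbourhoods of `x`, and the dilatations are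
homeomorphisms `U x → V ε x` for `0 < ε ≤ 1` and `W ε x → U x` for `1 < ε`. -/
structure IsHomeoField : Prop where
  isOpen_U : ∀ x, IsOpen (D.U x) ∧ x ∈ D.U x
  isOpen_V : ∀ x ε, 0 < ε → ε ≤ 1 → IsOpen (D.V ε x) ∧ x ∈ D.V ε x
  isOpen_W : ∀ x ε, 1 < ε → IsOpen (D.W ε x) ∧ x ∈ D.W ε x
  homeo_le : ∀ x ε, 0 < ε → ε ≤ 1 → ∃ e : D.U x ≃ₜ D.V ε x, ∀ u, (e u : X) = D.δ ε x u
  homeo_gt : ∀ x ε, 1 < ε → ∃ e : D.W ε x ≃ₜ D.U x, ∀ u, (e u : X) = D.δ ε x u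

/-- Axiom A0, with the numbers `1 < A < B`. -/
structure AxiomA0 (A B : ℝ) : Prop where
  homeoField : D.IsHomeoField
  one_lt_A : 1 < A
  A_lt_B : A < B
  ball_subset_U : ∀ x, ball x A ⊆ D.U x
  ball_subset_image : ∀ x ε, 0 < ε → ε < 1 → ball x ε ⊆ D.δ ε x '' ball x A
  image_subset_V : ∀ x ε, 0 < ε → ε < 1 → D.δ ε x '' ball x A ⊆ D.V ε x
  V_subset_W : ∀ x ε, 0 < ε → ε < 1 → D.V ε x ⊆ D.W ε⁻¹ x
  W_subset_image : ∀ x ε, 0 < ε → ε < 1 → D.W ε⁻¹ x ⊆ D.δ ε x '' (ball x B ∩ D.U x)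
  mem_W : ∀ K : Set X, IsCompact K → ∃ R > 0, ∃ ε₀ > 0, ε₀ < 1 ∧
    ∀ x ∈ K, ∀ u ∈ closedBall x R, ∀ v ∈ closedBall x R, ∀ ε, 0 < ε → ε < ε₀ →
      D.δ ε x v ∈ D.W ε⁻¹ (D.δ ε x u)

/-- Axiom A1. The closure of `dom` in `ℝ × X × X` is its closure in `[0,∞) × X × X`. -/
structure AxiomA1 : Prop where
  apply_self : ∀ x ε, 0 < ε → D.δ ε x x = x
  apply_one : ∀ x, ∀ u ∈ D.U x, D.δ 1 x u = u
  continuous_extension : ∃ E : ℝ × X × X → X, ContinuousOn E (closure D.dom) ∧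
    (∀ p ∈ D.dom, E p = D.δ p.1 p.2.1 p.2.2) ∧
    ∀ x y, ((0 : ℝ), x, y) ∈ closure D.dom → E (0, x, y) = x

/-- Axiom A2: `δ_ε^x δ_μ^x u = δ_{εμ}^x u` for `u ∈ U(x)` whenever both sides are defined. -/
def AxiomA2 : Prop :=
  ∀ x, ∀ ε μ : ℝ, 0 < ε → 0 < μ → ∀ u ∈ D.U x,
    u ∈ D.domAt μ x → D.δ μ x u ∈ D.domAt ε x → u ∈ D.domAt (ε * μ) x →
      D.δ ε x (D.δ μ x u) = D.δ (ε * μ) x u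

/-- The tangent distance `d^x(u,v) = lim_{ε → 0} d(δ_ε^x u, δ_ε^x v) / ε`. -/
noncomputable def tangentDist (x u v : X) : ℝ :=
  limUnder (𝓝[>] (0 : ℝ)) fun ε => dist (D.δ ε x u) (D.δ ε x v) / ε

/-- Axiom A3: on the closed balls of radius `A` the rescaled distances converge to `d^x`, uniformly
in the two points and locally uniformly in `x`, and `d^x` is a (nondegenerate) distance there. -/
structure AxiomA3 (A : ℝ) : Prop where
  closedBall_subset_U : ∀ x, closedBall x A ⊆ D.U x
  eq_zero_iff : ∀ x, ∀ u ∈ closedBall x A, ∀ v ∈ closedBall x A, D.tangentDist x u v = 0 ↔ u = v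
  symm : ∀ x, ∀ u ∈ closedBall x A, ∀ v ∈ closedBall x A,
    D.tangentDist x u v = D.tangentDist x v u
  triangle : ∀ x, ∀ u ∈ closedBall x A, ∀ v ∈ closedBall x A, ∀ w ∈ closedBall x A,
    D.tangentDist x u w ≤ D.tangentDist x u v + D.tangentDist x v w
  uniform_limit : ∀ K : Set X, IsCompact K → ∀ η > 0, ∀ᶠ ε in 𝓝[>] (0 : ℝ),
    ∀ x ∈ K, ∀ u ∈ closedBall x A, ∀ v ∈ closedBall x A,
      |dist (D.δ ε x u) (D.δ ε x v) / ε - D.tangentDist x u v| ≤ η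

/-- The approximate difference `Δ_ε^x(u,v)`, the dilatation of coefficient `ε⁻¹` based at
`δ_ε^x u`, applied to `δ_ε^x v`. -/
noncomputable def diffOp (ε : ℝ) (x u v : X) : X :=
  D.δ ε⁻¹ (D.δ ε x u) (D.δ ε x v)

/-- The approximate sum `Σ_ε^x(u,v)`: the dilatation of coefficient `ε` based at `δ_ε^x u` is
applied to `v`, then the dilatation of coefficient `ε⁻¹` based at `x`. -/
noncomputable def sumOp (ε : ℝ) (x u v : X) : X :=
  D.δ ε⁻¹ x (D.δ ε (D.δ ε x u) v)

/-- `Δ_ε^x(u,v)` is well defined (for `0 < ε < 1`). -/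
def DiffDefined (ε : ℝ) (x u v : X) : Prop :=
  u ∈ D.U x ∧ v ∈ D.U x ∧ D.δ ε x v ∈ D.W ε⁻¹ (D.δ ε x u)

/-- `Σ_ε^x(u,v)` is well defined (for `0 < ε < 1`). -/
def SumDefined (ε : ℝ) (x u v : X) : Prop :=
  u ∈ D.U x ∧ v ∈ D.U (D.δ ε x u) ∧ D.δ ε (D.δ ε x u) v ∈ D.W ε⁻¹ x

/-- The operations `Δ_ε` are defined for small `ε` and converge as `ε → 0`, uniformly for `x` in a
compact set and `u, v` close to `x`. -/
def DiffConverges : Prop :=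
  ∃ Δ : X → X → X → X, ∀ K : Set X, IsCompact K → ∃ R > 0, ∀ η > 0, ∀ᶠ ε in 𝓝[>] (0 : ℝ),
    ∀ x ∈ K, ∀ u ∈ closedBall x R, ∀ v ∈ closedBall x R,
      D.DiffDefined ε x u v ∧ dist (D.diffOp ε x u v) (Δ x u v) ≤ η

/-- The operations `Σ_ε` are defined for small `ε` and converge as `ε → 0`, uniformly for `x` in a
compact set and `u, v` close to `x`. -/
def SumConverges : Prop :=
  ∃ S : X → X → X → X, ∀ K : Set X, IsCompact K → ∃ R > 0, ∀ η > 0, ∀ᶠ ε in 𝓝[>] (0 : ℝ),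
    ∀ x ∈ K, ∀ u ∈ closedBall x R, ∀ v ∈ closedBall x R,
      D.SumDefined ε x u v ∧ dist (D.sumOp ε x u v) (S x u v) ≤ η

/-- Strong dilatation structures: complete metric spaces with compact closed balls of radius `3`,
with a field of dilatations satisfying A0, A1, A2, A3 and A4. -/
def IsStrongDilatationStructure : Prop :=
  CompleteSpace X ∧ (∀ x : X, IsCompact (closedBall x 3)) ∧
    (∃ A B : ℝ, D.AxiomA0 A B ∧ D.AxiomA3 A) ∧ D.AxiomA1 ∧ D.AxiomA2 ∧ D.DiffConverges

/-- Tempered: the distance is a length distance and the rescaled distances are bilipschitz with the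
tangent distances for `x, u, v` sufficiently close, with constants independent of the scale. -/
def IsTempered : Prop :=
  IsLengthDistance X ∧
    ∀ K : Set X, IsCompact K → ∃ c C ρ : ℝ, 0 < c ∧ c < C ∧ 0 < ρ ∧
      ∀ ε, 0 < ε → ε ≤ 1 → ∀ x ∈ K, ∀ u ∈ K, ∀ v ∈ K,
        dist x u ≤ ρ → dist x v ≤ ρ → dist u v ≤ ρ →
          c * D.tangentDist x u v ≤ dist (D.δ ε x u) (D.δ ε x v) / ε ∧
          dist (D.δ ε x u) (D.δ ε x v) / ε ≤ C * D.tangentDist x u v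

/-- The curve `c` is derivable at `t`: there is a morphism `f` of (local) conical groups, from a
neighbourhood of `0` in `(ℝ, +)` with its usual dilatations to the tangent space
`(U (c t), Σ, δ)` at `c t`, which approximates `c` to first order at `t`. -/
def DerivableAt (c : ℝ → X) (t : ℝ) : Prop :=
  ∃ r > 0, ∃ f : ℝ → X,
    (∀ a, |a| < r → f a ∈ D.U (c t)) ∧
    (∀ a b, |a| < r → |b| < r → |a + b| < r →
      Tendsto (fun ε => D.sumOp ε (c t) (f a) (f b)) (𝓝[>] (0 : ℝ)) (𝓝 (f (a + b)))) ∧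
    (∀ ε a, 0 < ε → ε ≤ 1 → |a| < r → f (ε * a) = D.δ ε (c t) (f a)) ∧
    ∀ η > 0, ∀ᶠ ε in 𝓝[>] (0 : ℝ), ∀ a, |a| < r →
      dist (c (t + ε * a)) (D.δ ε (c t) (f a)) / ε ≤ η

/-- The Radon–Nikodym property: Lipschitz curves are derivable almost everywhere. -/
def HasRadonNikodymProperty : Prop :=
  ∀ (a b : ℝ) (c : ℝ → X) (K : ℝ≥0), LipschitzOnWith K c (Icc a b) →
    ∀ᵐ t, t ∈ Ioo a b → D.DerivableAt c t

/-- The domain of the rescaled length functional `l_ε`: the pairs `(x, c)` with `c` a curve in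
`U x` such that `δ_ε^x c` is Lipschitz with constant at most twice its length. -/
def lengthDomain (ε : ℝ) : Set (X × C(I, X)) :=
  {p | (∀ t, p.2 t ∈ D.U p.1) ∧ ∃ K : ℝ≥0, LipschitzWith K (fun t => D.δ ε p.1 (p.2 t)) ∧
    (K : ℝ≥0∞) ≤ 2 * curveLength (fun t => D.δ ε p.1 (p.2 t))}

/-- The rescaled length functional `l_ε(x, c)`, the length of `δ_ε^x c` divided by `ε`. -/
noncomputable def rescaledLength (ε : ℝ) (p : X × C(I, X)) : ℝ≥0∞ :=
  ENNReal.ofReal ε⁻¹ * curveLength (fun t => D.δ ε p.1 (p.2 t))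

/-- The domain of the limit functional: the pairs `(x, c)`, with `c` a curve in `U x`, which are
limits of pairs `(x_n, c_n)` in the domains of `l_{ε_n}`, with `ε_n → 0` and `(c_n)`
equicontinuous. -/
def limitDomain : Set (X × C(I, X)) :=
  {p | (∀ t, p.2 t ∈ D.U p.1) ∧ ∃ (ε : ℕ → ℝ) (z : ℕ → X × C(I, X)),
    (∀ n, ε n ∈ Ioo (0 : ℝ) 1) ∧ Tendsto ε atTop (𝓝 0) ∧ (∀ n, z n ∈ D.lengthDomain (ε n)) ∧
    Equicontinuous (fun n t => (z n).2 t) ∧ Tendsto z atTop (𝓝 p)}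

/-- Axiom A3L. -/
def AxiomA3L : Prop :=
  ∃ l : X × C(I, X) → ℝ≥0∞, ∀ ε : ℕ → ℝ, (∀ n, ε n ∈ Ioo (0 : ℝ) 1) → Tendsto ε atTop (𝓝 0) →
    GammaConverges (fun n => D.lengthDomain (ε n)) (fun n => D.rescaledLength (ε n))
      D.limitDomain l

/-- Length dilatation structures: complete, locally compact metric spaces with a field of
dilatations satisfying A0, A1, A2, A3L and A4+. -/
def IsLengthDilatationStructure : Prop :=
  CompleteSpace X ∧ LocallyCompactSpace X ∧
    (∃ A B : ℝ, D.AxiomA0 A B) ∧ D.AxiomA1 ∧ D.AxiomA2 ∧ D.AxiomA3L ∧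
    D.DiffConverges ∧ D.SumConverges

end DilatationField

/-! Two assertions carry the content: the approximate sums converge, and the rescaled lengths
Gamma-converge.

Sums. Put y = δ_ε^x u and w = Δ_ε^x(u,x). The dilatation of coefficient ε at y carries w back to x,
so Σ_ε^x(u,v) = Δ_ε^y(w,v). The base points y tend to x, and the uniform limit Δ is continuous near
the diagonal. Hence the sums converge to Δ^x(Δ^x(u,x),v) (`sumDefined_and_sumOp_eq`,
`sumOp_converges_near`).

Lengths. The Gamma-limit is the maximum of the d^x-length and half the d^x-Lipschitz constant; the
second term is what survives of the constraint Lip ≤ 2 · length. Everything rests on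
`tendsto_rescaledDist`: the rescaled distances converge jointly in scale, base point and both
points, on all of U(x). The lower bound follows by passing to the limit in each finite sum and each
difference quotient (`limitLength_le_liminf`).

For recovery, keep x, subdivide c at the points i/N, and join the consecutive points δ_ε^x c(i/N) by
arcs of prescribed length. In a nontrivial length space every length above the distance is
available, since the surplus can be spent in small loops (`exists_isUnitArc_of_lt`). Choose a finite
M close to the limit value, let the lengths add up to εM and let none exceed 2εM/N; running each arc
at constant speed in time 1/N then meets the constraint. The curve pulls back under δ_ε^x to one
uniformly close to c, because a connected set of size small compared to ε cannot cross the image of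
a small sphere (`exists_pos_subset_image`). -/

namespace DilatationField

/-! ### Dilatations as local homeomorphisms, and their limit at scale zero -/

theorem domAt_of_le {X : Type*} {D : DilatationField X} {ε : ℝ} (h : ε ≤ 1) (x : X) :
    D.domAt ε x = D.U x := if_pos h

theorem domAt_of_lt {X : Type*} {D : DilatationField X} {ε : ℝ} (h : 1 < ε) (x : X) :
    D.domAt ε x = D.W ε x := if_neg h.not_ge

variable {X : Type*} [MetricSpace X] {D : DilatationField X}


theorem IsHomeoField.injOn (hD : D.IsHomeoField) {x : X} {ε : ℝ} (h0 : 0 < ε) (h1 : ε ≤ 1) :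
    InjOn (D.δ ε x) (D.U x) := by
  obtain ⟨e, he⟩ := hD.homeo_le x ε h0 h1
  intro u hu v hv huv
  have : e ⟨u, hu⟩ = e ⟨v, hv⟩ := Subtype.ext (by rw [he, he]; exact huv)
  exact congrArg Subtype.val (e.injective this)

theorem IsHomeoField.mapsTo_gt (hD : D.IsHomeoField) {x : X} {ε : ℝ} (h1 : 1 < ε) :
    MapsTo (D.δ ε x) (D.W ε x) (D.U x) := by
  obtain ⟨e, he⟩ := hD.homeo_gt x ε h1
  intro u hu
  rw [← he ⟨u, hu⟩]
  exact (e ⟨u, hu⟩).2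

theorem IsHomeoField.continuousOn (hD : D.IsHomeoField) {x : X} {ε : ℝ} (h0 : 0 < ε)
    (h1 : ε ≤ 1) : ContinuousOn (D.δ ε x) (D.U x) := by
  obtain ⟨e, he⟩ := hD.homeo_le x ε h0 h1
  rw [continuousOn_iff_continuous_domRestrict]
  have : (D.U x).domRestrict (D.δ ε x) = fun u => (e u : X) := funext fun u => (he u).symm
  rw [this]
  exact continuous_subtype_val.comp e.continuous

theorem IsHomeoField.isOpen_image (hD : D.IsHomeoField) {x : X} {ε : ℝ} (h0 : 0 < ε)
    (h1 : ε ≤ 1) {s : Set X} (hs : IsOpen s) (hsU : s ⊆ D.U x) : IsOpen (D.δ ε x '' s) := by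
  obtain ⟨e, he⟩ := hD.homeo_le x ε h0 h1
  have : D.δ ε x '' s = Subtype.val '' (e '' (Subtype.val ⁻¹' s)) := by
    ext y
    constructor
    · rintro ⟨u, hu, rfl⟩
      exact ⟨e ⟨u, hsU hu⟩, ⟨⟨u, hsU hu⟩, hu, rfl⟩, he _⟩
    · rintro ⟨_, ⟨u, hu, rfl⟩, rfl⟩
      exact ⟨u, hu, (he u).symm⟩
  rw [this]
  exact (hD.isOpen_V x ε h0 h1).1.isOpenMap_subtype_val _
    (e.isOpenMap _ (hs.preimage continuous_subtype_val))

theorem AxiomA1.continuousOn (h1 : D.AxiomA1) {ε : ℝ} (h0 : 0 < ε) :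
    ContinuousOn (fun p : X × X => D.δ ε p.1 p.2) {p | p.2 ∈ D.domAt ε p.1} := by
  obtain ⟨E, hE, hEδ, -⟩ := h1.continuous_extension
  have : ContinuousOn (fun p : X × X => E (ε, p)) {p | p.2 ∈ D.domAt ε p.1} :=
    hE.comp (by fun_prop) fun p hp => subset_closure ⟨h0, hp⟩
  exact this.congr fun p hp => (hEδ (ε, p) ⟨h0, hp⟩).symm

/-- For u in U(x) the point (0, x, u) is in the closure of the domain, being the limit of (ε, x, u),
so the continuous extension applies there. The base point and the argument may vary together with
the scale. -/
theorem AxiomA1.tendsto_zero (h1 : D.AxiomA1) {x u : X} (hu : u ∈ D.U x) :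
    Tendsto (fun q : ℝ × X × X => D.δ q.1 q.2.1 q.2.2)
      (𝓝[{q | 0 < q.1 ∧ q.1 ≤ 1 ∧ q.2.2 ∈ D.U q.2.1}] (0, x, u)) (𝓝 x) := by
  obtain ⟨E, hE, hEδ, hE0⟩ := h1.continuous_extension
  have hcl : ((0 : ℝ), x, u) ∈ closure D.dom := by
    rw [mem_closure_iff_frequently]
    have hc : Tendsto (fun ε : ℝ => (ε, x, u)) (𝓝[>] 0) (𝓝 (0, x, u)) :=
      (Continuous.tendsto' (by fun_prop) _ _ rfl).mono_left nhdsWithin_le_nhds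
    refine hc.frequently (Eventually.frequently ?_)
    filter_upwards [Ioo_mem_nhdsGT (zero_lt_one' ℝ)] with ε hε
    exact ⟨hε.1, by rw [domAt_of_le hε.2.le]; exact hu⟩
  have hsub : {q : ℝ × X × X | 0 < q.1 ∧ q.1 ≤ 1 ∧ q.2.2 ∈ D.U q.2.1} ⊆ D.dom :=
    fun q hq => ⟨hq.1, by rw [domAt_of_le hq.2.1]; exact hq.2.2⟩
  have := (hE _ hcl).mono_left (nhdsWithin_mono _ (hsub.trans subset_closure))
  rw [hE0 x u hcl] at this
  refine this.congr' ?_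
  filter_upwards [self_mem_nhdsWithin] with q hq
  exact hEδ q (hsub hq)

theorem AxiomA1.tendsto_zero_right (h1 : D.AxiomA1) {x u : X} (hu : u ∈ D.U x) :
    Tendsto (fun ε => D.δ ε x u) (𝓝[>] 0) (𝓝 x) := by
  refine (h1.tendsto_zero hu).comp (f := fun ε : ℝ => (ε, x, u)) ?_
  refine tendsto_nhdsWithin_iff.2
    ⟨(Continuous.tendsto' (by fun_prop) _ _ rfl).mono_left nhdsWithin_le_nhds, ?_⟩
  filter_upwards [Ioo_mem_nhdsGT (zero_lt_one' ℝ)] with ε hε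
  exact ⟨hε.1, hε.2.le, hu⟩

/-! ### Rescaled distances and the tangent distance -/

/-- The rescaled distance `d(δ_ε^x u, δ_ε^x v) / ε`, as a function of `(ε, x, u, v)`. -/
noncomputable def rescaledDist (D : DilatationField X) (q : ℝ × X × X × X) : ℝ :=
  dist (D.δ q.1 q.2.1 q.2.2.1) (D.δ q.1 q.2.1 q.2.2.2) / q.1

/-- The parameters `(ε, x, u, v)` with `ε > 0` and `u, v ∈ U x`. -/
def rescaledDom (D : DilatationField X) : Set (ℝ × X × X × X) :=
  {q | 0 < q.1 ∧ q.2.2.1 ∈ D.U q.2.1 ∧ q.2.2.2 ∈ D.U q.2.1}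

theorem AxiomA1.continuousOn_rescaledDist (h1 : D.AxiomA1) {ε : ℝ} (h0 : 0 < ε) (hε : ε ≤ 1) :
    ContinuousOn (fun p : X × X × X => D.rescaledDist (ε, p))
      {p | p.2.1 ∈ D.U p.1 ∧ p.2.2 ∈ D.U p.1} := by
  have h := h1.continuousOn h0
  simp only [domAt_of_le hε] at h
  refine ContinuousOn.div_const (continuous_dist.comp_continuousOn (ContinuousOn.prodMk ?_ ?_)) _
  · exact h.comp (f := fun p : X × X × X => (p.1, p.2.1)) (by fun_prop) fun p hp => hp.1
  · exact h.comp (f := fun p : X × X × X => (p.1, p.2.2)) (by fun_prop) fun p hp => hp.2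

/-- The uniform limit inherits continuity: one fixed small scale ε₁, where the rescaled distance is
continuous in all three points, serves as an intermediary between the moving and the limit
parameters. Four errors of size η/5 stay below η. -/
theorem tendsto_rescaledDist_of_ball (hcpt : ∀ x : X, IsCompact (closedBall x 3)) {A : ℝ}
    (h1 : D.AxiomA1) (h3 : D.AxiomA3 A) {x u v : X} (hu : u ∈ ball x A) (hv : v ∈ ball x A) :
    Tendsto D.rescaledDist (𝓝[D.rescaledDom] (0, x, u, v)) (𝓝 (D.tangentDist x u v)) := by
  rw [Metric.tendsto_nhds]
  intro η hη
  have hη4 : 0 < η / 5 := by positivity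
  have hunif := h3.uniform_limit _ (hcpt x) _ hη4
  obtain ⟨ε₁, hε₁, hε₁0, hε₁1⟩ :=
    (hunif.and (Ioo_mem_nhdsGT (zero_lt_one' ℝ))).exists
  have hxU : (x, u, v) ∈ {p : X × X × X | p.2.1 ∈ D.U p.1 ∧ p.2.2 ∈ D.U p.1} :=
    ⟨h3.closedBall_subset_U x (ball_subset_closedBall hu),
      h3.closedBall_subset_U x (ball_subset_closedBall hv)⟩
  have hcont := h1.continuousOn_rescaledDist hε₁0 hε₁1.le _ hxU
  have hsnd : Tendsto (Prod.snd : ℝ × X × X × X → X × X × X)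
      (𝓝[D.rescaledDom] (0, x, u, v))
      (𝓝[{p : X × X × X | p.2.1 ∈ D.U p.1 ∧ p.2.2 ∈ D.U p.1}] (x, u, v)) :=
    tendsto_nhdsWithin_iff.2 ⟨(continuous_snd.tendsto _).mono_left nhdsWithin_le_nhds, by
      filter_upwards [self_mem_nhdsWithin] with q hq using hq.2⟩
  have hfst : Tendsto (Prod.fst : ℝ × X × X × X → ℝ) (𝓝[D.rescaledDom] (0, x, u, v)) (𝓝[>] 0) :=
    tendsto_nhdsWithin_iff.2 ⟨(continuous_fst.tendsto _).mono_left nhdsWithin_le_nhds, by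
      filter_upwards [self_mem_nhdsWithin] with q hq using hq.1⟩
  have hO1 : IsOpen {q : ℝ × X × X × X | dist q.2.1 x < 3} :=
    isOpen_lt (by fun_prop) continuous_const
  have hO2 : IsOpen {q : ℝ × X × X × X | dist q.2.2.1 q.2.1 < A} :=
    isOpen_lt (by fun_prop) continuous_const
  have hO3 : IsOpen {q : ℝ × X × X × X | dist q.2.2.2 q.2.1 < A} :=
    isOpen_lt (by fun_prop) continuous_const
  filter_upwards [hfst.eventually hunif,
    hsnd.eventually (Metric.tendsto_nhds.1 hcont _ hη4),
    mem_nhdsWithin_of_mem_nhds (hO1.mem_nhds (by simp)),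
    mem_nhdsWithin_of_mem_nhds (hO2.mem_nhds hu),
    mem_nhdsWithin_of_mem_nhds (hO3.mem_nhds hv)] with q hq1 hq2 hq3 hq4 hq5
  have a1 := abs_le.1 (hq1 q.2.1 (mem_closedBall.2 (le_of_lt hq3)) _
    (mem_closedBall.2 (le_of_lt hq4)) _ (mem_closedBall.2 (le_of_lt hq5)))
  have a2 := abs_le.1 (hε₁ q.2.1 (mem_closedBall.2 (le_of_lt hq3)) _
    (mem_closedBall.2 (le_of_lt hq4)) _ (mem_closedBall.2 (le_of_lt hq5)))
  have a3 := abs_le.1 (hε₁ x (mem_closedBall_self (by norm_num)) u (ball_subset_closedBall hu) v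
    (ball_subset_closedBall hv))
  rw [Real.dist_eq] at hq2 ⊢
  have a4 := abs_lt.1 hq2
  simp only [rescaledDist] at a4 ⊢
  rw [abs_lt]
  constructor <;> linarith [a1.1, a1.2, a2.1, a2.2, a3.1, a3.2, a4.1, a4.2]

/-- A3 only controls the ball of radius A, but a dilatation of small coefficient μ moves both points
into it, and by A2 the rescaled distance at scale ε is 1/μ times that of the moved points at scale
ε/μ. -/
theorem exists_tendsto_rescaledDist (hcpt : ∀ x : X, IsCompact (closedBall x 3)) {A : ℝ}
    (hA : 0 < A) (h1 : D.AxiomA1) (h2 : D.AxiomA2) (h3 : D.AxiomA3 A) {x u v : X}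
    (hu : u ∈ D.U x) (hv : v ∈ D.U x) :
    ∃ μ, 0 < μ ∧ μ < 1 ∧ D.δ μ x u ∈ ball x A ∧ D.δ μ x v ∈ ball x A ∧
      Tendsto D.rescaledDist (𝓝[D.rescaledDom] (0, x, u, v))
        (𝓝 (D.tangentDist x (D.δ μ x u) (D.δ μ x v) / μ)) := by
  obtain ⟨μ, ⟨⟨hμu, hμv⟩, hμ0, hμ1⟩⟩ :=
    (((h1.tendsto_zero_right hu).eventually (ball_mem_nhds x hA)).and
      ((h1.tendsto_zero_right hv).eventually (ball_mem_nhds x hA))).and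
      (Ioo_mem_nhdsGT (zero_lt_one' ℝ)) |>.exists
  refine ⟨μ, hμ0, hμ1, hμu, hμv, ?_⟩
  have hδ := h1.continuousOn hμ0
  simp only [domAt_of_le hμ1.le] at hδ
  have hmem : ∀ᶠ q in 𝓝[D.rescaledDom] ((0 : ℝ), x, u, v), q ∈ D.rescaledDom :=
    self_mem_nhdsWithin
  have hx : Tendsto (fun q : ℝ × X × X × X => q.2.1) (𝓝[D.rescaledDom] (0, x, u, v)) (𝓝 x) :=
    (Continuous.tendsto' (by fun_prop) _ _ rfl).mono_left nhdsWithin_le_nhds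
  have hε : Tendsto (fun q : ℝ × X × X × X => q.1) (𝓝[D.rescaledDom] (0, x, u, v)) (𝓝 0) :=
    (Continuous.tendsto' (by fun_prop) _ _ rfl).mono_left nhdsWithin_le_nhds
  have hu' : Tendsto (fun q : ℝ × X × X × X => D.δ μ q.2.1 q.2.2.1)
      (𝓝[D.rescaledDom] (0, x, u, v)) (𝓝 (D.δ μ x u)) :=
    Tendsto.comp (hδ (x, u) hu) (tendsto_nhdsWithin_iff.2
      ⟨(Continuous.tendsto' (by fun_prop) _ _ rfl).mono_left nhdsWithin_le_nhds,
        hmem.mono fun q hq => hq.2.1⟩ :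
        Tendsto (fun q : ℝ × X × X × X => (q.2.1, q.2.2.1)) _ _)
  have hv' : Tendsto (fun q : ℝ × X × X × X => D.δ μ q.2.1 q.2.2.2)
      (𝓝[D.rescaledDom] (0, x, u, v)) (𝓝 (D.δ μ x v)) :=
    Tendsto.comp (hδ (x, v) hv) (tendsto_nhdsWithin_iff.2
      ⟨(Continuous.tendsto' (by fun_prop) _ _ rfl).mono_left nhdsWithin_le_nhds,
        hmem.mono fun q hq => hq.2.2⟩ :
        Tendsto (fun q : ℝ × X × X × X => (q.2.1, q.2.2.2)) _ _)
  have hcl : ∀ {w : ℝ × X × X × X → X} {w₀ : X}, w₀ ∈ ball x A →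
      Tendsto w (𝓝[D.rescaledDom] (0, x, u, v)) (𝓝 w₀) →
      ∀ᶠ q in 𝓝[D.rescaledDom] ((0 : ℝ), x, u, v), w q ∈ D.U q.2.1 := by
    intro w w₀ hw₀ hw
    filter_upwards [(hw.dist hx).eventually (gt_mem_nhds hw₀)] with q hq
    exact h3.closedBall_subset_U _ (mem_closedBall.2 hq.le)
  have hmain := (tendsto_rescaledDist_of_ball hcpt h1 h3 hμu hμv).comp
    (tendsto_nhdsWithin_iff.2 ⟨(by simpa using hε.div_const μ : Tendsto (fun q : ℝ × X × X × X =>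
      q.1 / μ) _ (𝓝 0)).prodMk_nhds (hx.prodMk_nhds (hu'.prodMk_nhds hv')), by
        filter_upwards [hmem, hcl hμu hu', hcl hμv hv'] with q hq hq1 hq2
        exact ⟨div_pos hq.1 hμ0, hq1, hq2⟩⟩)
  refine (hmain.div_const μ).congr' ?_
  filter_upwards [hmem, hcl hμu hu', hcl hμv hv', hε.eventually (gt_mem_nhds hμ0)]
    with q hq hq1 hq2 hq3
  have hle : q.1 / μ ≤ 1 := (div_le_one hμ0).2 hq3.le
  have hpos : 0 < q.1 / μ := div_pos hq.1 hμ0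
  have hmul : q.1 / μ * μ = q.1 := div_mul_cancel₀ _ hμ0.ne'
  have key : ∀ w ∈ D.U q.2.1, D.δ μ q.2.1 w ∈ D.U q.2.1 →
      D.δ (q.1 / μ) q.2.1 (D.δ μ q.2.1 w) = D.δ q.1 q.2.1 w := by
    intro w hw hw'
    rw [h2 q.2.1 (q.1 / μ) μ hpos hμ0 w hw (by rwa [domAt_of_le hμ1.le])
      (by rwa [domAt_of_le hle]) (by rw [hmul, domAt_of_le (hq3.le.trans hμ1.le)]; exact hw), hmul]
  simp only [Function.comp, rescaledDist]
  rw [key _ hq.2.1 hq1, key _ hq.2.2 hq2, div_div, hmul]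

theorem tendsto_prodMk_rescaledDom {x u v : X} (hu : u ∈ D.U x) (hv : v ∈ D.U x) :
    Tendsto (fun ε : ℝ => (ε, x, u, v)) (𝓝[>] 0) (𝓝[D.rescaledDom] (0, x, u, v)) :=
  tendsto_nhdsWithin_iff.2
    ⟨(Continuous.tendsto' (by fun_prop) _ _ rfl).mono_left nhdsWithin_le_nhds, by
      filter_upwards [self_mem_nhdsWithin] with ε hε using ⟨hε, hu, hv⟩⟩

/-- The rescaled distances converge to the tangent distance, jointly in the scale and in the three
points, on the whole chart domains. -/
theorem tendsto_rescaledDist (hcpt : ∀ x : X, IsCompact (closedBall x 3)) {A : ℝ}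
    (hA : 0 < A) (h1 : D.AxiomA1) (h2 : D.AxiomA2) (h3 : D.AxiomA3 A) {x u v : X}
    (hu : u ∈ D.U x) (hv : v ∈ D.U x) :
    Tendsto D.rescaledDist (𝓝[D.rescaledDom] (0, x, u, v)) (𝓝 (D.tangentDist x u v)) := by
  obtain ⟨μ, -, -, -, -, h⟩ := exists_tendsto_rescaledDist hcpt hA h1 h2 h3 hu hv
  have hlim : D.tangentDist x u v = D.tangentDist x (D.δ μ x u) (D.δ μ x v) / μ :=
    (h.comp (tendsto_prodMk_rescaledDom hu hv)).limUnder_eq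
  rwa [hlim]

/-- Nondegeneracy on the ball of radius A passes to U(x) because the shrinking dilatation δ_μ^x is
injective. -/
theorem tangentDist_pos (hcpt : ∀ x : X, IsCompact (closedBall x 3)) {A : ℝ}
    (hA : 0 < A) (hU : D.IsHomeoField) (h1 : D.AxiomA1) (h2 : D.AxiomA2) (h3 : D.AxiomA3 A)
    {x u v : X} (hu : u ∈ D.U x) (hv : v ∈ D.U x) (huv : u ≠ v) : 0 < D.tangentDist x u v := by
  obtain ⟨μ, hμ0, hμ1, hμu, hμv, h⟩ := exists_tendsto_rescaledDist hcpt hA h1 h2 h3 hu hv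
  have h' := h.comp (tendsto_prodMk_rescaledDom hu hv)
  have hlim : D.tangentDist x u v = D.tangentDist x (D.δ μ x u) (D.δ μ x v) / μ := h'.limUnder_eq
  have hnn : 0 ≤ D.tangentDist x u v := by
    rw [hlim]
    refine ge_of_tendsto h' ?_
    filter_upwards [self_mem_nhdsWithin] with ε hε
    exact div_nonneg dist_nonneg (le_of_lt hε)
  refine hnn.lt_of_ne fun h0 => huv ?_
  rw [hlim, eq_comm, div_eq_zero_iff, or_iff_left hμ0.ne',
    h3.eq_zero_iff x _ (ball_subset_closedBall hμu) _ (ball_subset_closedBall hμv)] at h0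
  exact hU.injOn hμ0 hμ1.le hu hv h0

/-! ### Convergence of the approximate sums -/

theorem AxiomA1.eventually_dist_lt (h1 : D.AxiomA1) {Q : Set (X × X)} (hQ : IsCompact Q)
    (hQU : ∀ q ∈ Q, q.2 ∈ D.U q.1) {κ : ℝ} (hκ : 0 < κ) :
    ∀ᶠ ε in 𝓝[>] (0 : ℝ), ∀ q ∈ Q, dist (D.δ ε q.1 q.2) q.1 < κ := by
  have key : ∀ᶠ ε in 𝓝 (0 : ℝ), ∀ q ∈ Q, 0 < ε → ε ≤ 1 → q.2 ∈ D.U q.1 →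
      dist (D.δ ε q.1 q.2) q.1 < κ := by
    refine hQ.eventually_forall_of_forall_eventually fun q hq => ?_
    have hfst : Tendsto (fun p : ℝ × X × X => p.2.1)
        (𝓝[{q | 0 < q.1 ∧ q.1 ≤ 1 ∧ q.2.2 ∈ D.U q.2.1}] (0, q)) (𝓝 q.1) :=
      (Continuous.tendsto' (by fun_prop) _ _ rfl).mono_left nhdsWithin_le_nhds
    have := ((h1.tendsto_zero (hQU q hq)).dist hfst).eventually
      (gt_mem_nhds (by simpa using hκ))
    filter_upwards [eventually_nhdsWithin_iff.1 this] with p hp h0 hle hU using hp ⟨h0, hle, hU⟩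
  filter_upwards [nhdsWithin_le_nhds key, Ioo_mem_nhdsGT (zero_lt_one' ℝ)] with ε h hε q hq
  exact h q hq hε.1 hε.2.le (hQU q hq)

theorem AxiomA1.continuousOn_diffOp (h1 : D.AxiomA1) {ε : ℝ} (h0 : 0 < ε) (hε : ε < 1) :
    ContinuousOn (fun p : X × X × X => D.diffOp ε p.1 p.2.1 p.2.2)
      {p | D.DiffDefined ε p.1 p.2.1 p.2.2} := by
  have hc := h1.continuousOn h0
  have hc' := h1.continuousOn (inv_pos.2 h0)
  simp only [domAt_of_le hε.le] at hc
  simp only [domAt_of_lt ((one_lt_inv₀ h0).2 hε)] at hc'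
  refine hc'.comp (f := fun p : X × X × X => (D.δ ε p.1 p.2.1, D.δ ε p.1 p.2.2))
    (ContinuousOn.prodMk ?_ ?_) fun p hp => hp.2.2
  · exact hc.comp (f := fun p : X × X × X => (p.1, p.2.1)) (by fun_prop) fun p hp => hp.1
  · exact hc.comp (f := fun p : X × X × X => (p.1, p.2.2)) (by fun_prop) fun p hp => hp.2.1

/-- The approximate sum is an approximate difference based at `δ_ε^x u`. -/
theorem sumDefined_and_sumOp_eq (hD : D.IsHomeoField) (h1 : D.AxiomA1) (h2 : D.AxiomA2)
    {ε : ℝ} (h0 : 0 < ε) (hε : ε < 1) {x u v : X} (hxU : x ∈ D.U (D.δ ε x u))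
    (hdiff : D.DiffDefined ε x u x)
    (hdiff' : D.DiffDefined ε (D.δ ε x u) (D.diffOp ε x u x) v) :
    D.SumDefined ε x u v ∧
      D.sumOp ε x u v = D.diffOp ε (D.δ ε x u) (D.diffOp ε x u x) v := by
  have hinv : 1 < ε⁻¹ := (one_lt_inv₀ h0).2 hε
  have hW : x ∈ D.W ε⁻¹ (D.δ ε x u) := by
    have := hdiff.2.2
    rwa [h1.apply_self x ε h0] at this
  have hmul : ε * ε⁻¹ = 1 := mul_inv_cancel₀ h0.ne'
  -- As δ_ε^x fixes x, the difference Δ_ε^x(u,x) is the dilatation of coefficient 1/ε at δ_ε^x u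
  -- applied to x; A2 with product 1 inverts it.
  have hback : D.δ ε (D.δ ε x u) (D.diffOp ε x u x) = x := by
    rw [diffOp, h1.apply_self x ε h0,
      h2 _ ε ε⁻¹ h0 (inv_pos.2 h0) x hxU (by rwa [domAt_of_lt hinv])
        (by rw [domAt_of_le hε.le]; exact hD.mapsTo_gt hinv hW)
        (by rwa [hmul, domAt_of_le le_rfl]), hmul, h1.apply_one _ _ hxU]
  have hS := hdiff'.2.2
  rw [hback] at hS
  exact ⟨⟨hdiff.1, hdiff'.2.1, hS⟩, by rw [sumOp, diffOp, hback]⟩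

theorem isCompact_closedBall_triples (hcpt : ∀ x : X, IsCompact (closedBall x 3)) (x₀ : X)
    {R : ℝ} (hR : R ≤ 1) :
    IsCompact {p : X × X × X | dist p.1 x₀ ≤ 1 ∧ dist p.2.1 p.1 ≤ R ∧ dist p.2.2 p.1 ≤ R} := by
  refine ((hcpt x₀).prod ((hcpt x₀).prod (hcpt x₀))).of_isClosed_subset ?_ ?_
  · simp only [ofPred_and]
    exact (isClosed_le (by fun_prop) continuous_const).inter
      ((isClosed_le (by fun_prop) continuous_const).inter
        (isClosed_le (by fun_prop) continuous_const))
  · rintro ⟨x, u, v⟩ ⟨hx, hu, hv⟩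
    refine ⟨mem_closedBall.2 (by simp at *; linarith), mem_closedBall.2 ?_, mem_closedBall.2 ?_⟩
    · have := dist_triangle u x x₀
      simp only at *
      linarith
    · have := dist_triangle v x x₀
      simp only at *
      linarith

/-- Convergence of the approximate differences near a point implies convergence of the approximate
sums near this point, the limit being `Δ^x(Δ^x(u, x), v)`. -/
theorem sumOp_converges_near (hcpt : ∀ x : X, IsCompact (closedBall x 3)) {A : ℝ}
    (hA : 1 < A) (hD : D.IsHomeoField) (h1 : D.AxiomA1) (h2 : D.AxiomA2)
    (hAU : ∀ x, closedBall x A ⊆ D.U x) {Δ : X → X → X → X} {R : ℝ} {x₀ : X} (hR : 0 < R)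
    (hR1 : R ≤ 1)
    (hΔ : ∀ η > 0, ∀ᶠ ε in 𝓝[>] (0 : ℝ), ∀ x ∈ closedBall x₀ 1, ∀ u ∈ closedBall x R,
      ∀ v ∈ closedBall x R, D.DiffDefined ε x u v ∧ dist (D.diffOp ε x u v) (Δ x u v) ≤ η) :
    ∃ r > 0, ∀ η > 0, ∀ᶠ ε in 𝓝[>] (0 : ℝ), ∀ x ∈ closedBall x₀ r, ∀ u ∈ closedBall x r,
      ∀ v ∈ closedBall x r, D.SumDefined ε x u v ∧
        dist (D.sumOp ε x u v) (Δ x (Δ x u x) v) ≤ η := by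
  set G : Set (X × X × X) :=
    {p | dist p.1 x₀ ≤ 1 ∧ dist p.2.1 p.1 ≤ R ∧ dist p.2.2 p.1 ≤ R} with hG
  have hGc : IsCompact G := isCompact_closedBall_triples hcpt x₀ hR1
  have hsmall : ∀ᶠ ε in 𝓝[>] (0 : ℝ), ε ∈ Ioo (0 : ℝ) 1 := Ioo_mem_nhdsGT zero_lt_one
  have hunif : TendstoUniformlyOn (fun ε (p : X × X × X) => D.diffOp ε p.1 p.2.1 p.2.2)
      (fun p => Δ p.1 p.2.1 p.2.2) (𝓝[>] (0 : ℝ)) G := by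
    rw [Metric.tendstoUniformlyOn_iff]
    intro η hη
    filter_upwards [hΔ (η / 2) (half_pos hη)] with ε hε p hp
    rw [dist_comm]
    have := (hε p.1 hp.1 p.2.1 hp.2.1 p.2.2 hp.2.2).2
    linarith
  have hcont : ContinuousOn (fun p : X × X × X => Δ p.1 p.2.1 p.2.2) G := by
    refine hunif.continuousOn (Eventually.frequently ?_)
    filter_upwards [hΔ 1 one_pos, hsmall] with ε hε hε1
    exact (h1.continuousOn_diffOp hε1.1 hε1.2).mono
      fun p hp => (hε p.1 hp.1 p.2.1 hp.2.1 p.2.2 hp.2.2).1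
  have hself : Δ x₀ x₀ x₀ = x₀ := by
    refine (dist_le_zero.1 (le_of_forall_pos_le_add fun η hη => ?_)).symm
    obtain ⟨ε, hε, hε1⟩ := ((hΔ η hη).and hsmall).exists
    have := (hε x₀ (mem_closedBall_self zero_le_one) x₀ (mem_closedBall_self hR.le) x₀
      (mem_closedBall_self hR.le)).2
    rwa [diffOp, h1.apply_self _ _ hε1.1, h1.apply_self _ _ (inv_pos.2 hε1.1), ← zero_add η]
      at this
  have hx₀G : (x₀, x₀, x₀) ∈ G := by simp [hG, hR.le]
  -- The radius must be fixed before η. Since Δ^{x₀}(x₀,x₀) = x₀, continuity keeps Δ^x(u,x) near x₀,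
  -- and the margins R/8 keep all later arguments inside `G`.
  obtain ⟨r₁, hr₁, hclose⟩ := Metric.continuousOn_iff.1 hcont _ hx₀G (R / 8) (by positivity)
  refine ⟨min (r₁ / 4) (R / 8), by positivity, fun η hη => ?_⟩
  set r := min (r₁ / 4) (R / 8) with hr
  have hr_r₁ : r ≤ r₁ / 4 := min_le_left _ _
  have hr_R : r ≤ R / 8 := min_le_right _ _
  have hr0 : 0 < r := by positivity
  -- Replacing the base point δ_ε^x u by x and Δ_ε^x(u,x) by its limit moves the arguments of Δ by
  -- less than κ, at a cost below η/2.
  obtain ⟨κ₀, hκ₀, hUC⟩ := Metric.uniformContinuousOn_iff.1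
    (hGc.uniformContinuousOn_of_continuous hcont) (η / 2) (half_pos hη)
  set κ := min κ₀ (R / 4) with hκ
  have hκ_κ₀ : κ ≤ κ₀ := min_le_left _ _
  have hκ_R : κ ≤ R / 4 := min_le_right _ _
  have hκ0 : 0 < κ := by positivity
  have hQ : IsCompact {q : X × X | dist q.1 x₀ ≤ 1 ∧ dist q.2 q.1 ≤ R} := by
    refine (hGc.image (f := fun p : X × X × X => (p.1, p.2.1)) (by fun_prop)).of_isClosed_subset ?_ ?_
    · simp only [ofPred_and]
      exact (isClosed_le (by fun_prop) continuous_const).inter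
        (isClosed_le (by fun_prop) continuous_const)
    rintro ⟨x, u⟩ ⟨hx, hu⟩
    exact ⟨(x, u, u), ⟨hx, hu, hu⟩, rfl⟩
  filter_upwards [hΔ (min (η / 2) (κ / 2)) (by positivity), hsmall,
    h1.eventually_dist_lt hQ (fun q hq => hAU _ (mem_closedBall.2 (hq.2.trans (hR1.trans hA.le))))
      (half_pos hκ0)] with ε hε hε1 hεκ x hx u hu v hv
  rw [mem_closedBall] at hx hu hv
  have hxx₀ : dist x x₀ ≤ 1 := by linarith
  have huR : dist u x ≤ R := by linarith
  have hy : dist (D.δ ε x u) x < κ / 2 := hεκ (x, u) ⟨hxx₀, huR⟩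
  have hyx₀ : dist (D.δ ε x u) x₀ ≤ 1 := by linarith [dist_triangle (D.δ ε x u) x x₀]
  obtain ⟨hdiff, hw⟩ := hε x hxx₀ u huR x (mem_closedBall_self hR.le)
  have hΔx : dist (Δ x u x) x ≤ R / 4 := by
    have h : dist (Δ x u x) (Δ x₀ x₀ x₀) < R / 8 := by
      refine hclose (x, u, x) ⟨hxx₀, huR, by simp [hR.le]⟩ ?_
      have := dist_triangle u x x₀
      simp only [Prod.dist_eq]
      rw [max_lt_iff, max_lt_iff]
      refine ⟨?_, ?_, ?_⟩ <;> linarith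
    rw [hself] at h
    linarith [dist_triangle_right (Δ x u x) x x₀]
  have hw' : dist (D.diffOp ε x u x) (Δ x u x) ≤ κ / 2 := hw.trans (min_le_right _ _)
  have hwy : dist (D.diffOp ε x u x) (D.δ ε x u) ≤ R := by
    have := dist_triangle4 (D.diffOp ε x u x) (Δ x u x) x (D.δ ε x u)
    rw [dist_comm x] at this
    linarith
  have hvy : dist v (D.δ ε x u) ≤ R := by
    linarith [dist_triangle_right v (D.δ ε x u) x]
  obtain ⟨hdiff', hfin⟩ := hε _ hyx₀ _ hwy _ hvy
  obtain ⟨hsum, heq⟩ := sumDefined_and_sumOp_eq hD h1 h2 hε1.1 hε1.2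
    (hAU _ (mem_closedBall'.2 (by linarith))) hdiff hdiff'
  refine ⟨hsum, ?_⟩
  rw [heq]
  have hlast := hUC (D.δ ε x u, D.diffOp ε x u x, v) ⟨hyx₀, hwy, hvy⟩ (x, Δ x u x, v)
    ⟨hxx₀, hΔx.trans (by linarith), by simp only; linarith⟩ (by
      simp only [Prod.dist_eq, dist_self]
      rw [max_lt_iff, max_lt_iff]
      refine ⟨?_, ?_, ?_⟩ <;> linarith)
  have := dist_triangle (D.diffOp ε (D.δ ε x u) (D.diffOp ε x u x) v)
    (Δ (D.δ ε x u) (D.diffOp ε x u x) v) (Δ x (Δ x u x) v)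
  have := hfin.trans (min_le_left _ _)
  simp only at hlast
  linarith

/-- Finitely many balls from `sumOp_converges_near` cover a compact set. The local statements glue
because Δ, hence the formula for the limit, is the same for all compact sets. -/
theorem DiffConverges.sumConverges (h4 : D.DiffConverges)
    (hcpt : ∀ x : X, IsCompact (closedBall x 3)) {A : ℝ}
    (hA : 1 < A) (hD : D.IsHomeoField) (h1 : D.AxiomA1) (h2 : D.AxiomA2)
    (hAU : ∀ x, closedBall x A ⊆ D.U x) : D.SumConverges := by
  obtain ⟨Δ, hΔ⟩ := h4
  refine ⟨fun x u v => Δ x (Δ x u x) v, fun K hK => ?_⟩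
  refine hK.induction_on (p := fun K => ∃ R > 0, ∀ η > 0, ∀ᶠ ε in 𝓝[>] (0 : ℝ),
    ∀ x ∈ K, ∀ u ∈ closedBall x R, ∀ v ∈ closedBall x R,
      D.SumDefined ε x u v ∧ dist (D.sumOp ε x u v) (Δ x (Δ x u x) v) ≤ η) ?_ ?_ ?_ ?_
  · exact ⟨1, one_pos, fun η _ => by simp⟩
  · rintro s t hst ⟨R, hR, h⟩
    exact ⟨R, hR, fun η hη => (h η hη).mono fun ε hε x hx => hε x (hst hx)⟩
  · rintro s t ⟨R, hR, h⟩ ⟨R', hR', h'⟩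
    refine ⟨min R R', lt_min hR hR', fun η hη => ?_⟩
    filter_upwards [h η hη, h' η hη] with ε hε hε' x hx u hu v hv
    have hs := closedBall_subset_closedBall (x := x) (min_le_left R R')
    have ht := closedBall_subset_closedBall (x := x) (min_le_right R R')
    rcases hx with hx | hx
    · exact hε x hx u (hs hu) v (hs hv)
    · exact hε' x hx u (ht hu) v (ht hv)
  · intro x₀ _
    obtain ⟨R, hR, h⟩ := hΔ (closedBall x₀ 1)
      ((hcpt x₀).of_isClosed_subset isClosed_closedBall
        (closedBall_subset_closedBall (by norm_num)))
    obtain ⟨r, hr, hlim⟩ := sumOp_converges_near (Δ := Δ) (x₀ := x₀) hcpt hA hD h1 h2 hAU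
      (lt_min hR one_pos) (min_le_right R 1) fun η hη => by
        filter_upwards [h η hη] with ε hε x hx u hu v hv
        have hs := closedBall_subset_closedBall (x := x) (min_le_left R 1)
        exact hε x hx u (hs hu) v (hs hv)
    exact ⟨closedBall x₀ r, mem_nhdsWithin_of_mem_nhds (closedBall_mem_nhds x₀ hr), r, hr, hlim⟩

end DilatationField

/-! ### Curves of prescribed length in a length space -/

section Arcs

variable {X : Type*} [MetricSpace X]

/-- Two curves, the second one starting at the end of the first one, can be concatenated. -/
theorem exists_concat {f g : ℝ → X} {a b : ℝ} {K : ℝ≥0} (ha : 0 ≤ a) (hb : 0 ≤ b)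
    (hfg : f a = g 0) (hf : LipschitzOnWith K f (Icc 0 a)) (hg : LipschitzOnWith K g (Icc 0 b)) :
    ∃ h : ℝ → X, LipschitzOnWith K h (Icc 0 (a + b)) ∧
      eVariationOn h (Icc 0 (a + b)) = eVariationOn f (Icc 0 a) + eVariationOn g (Icc 0 b) ∧
      EqOn h f (Icc 0 a) ∧ ∀ t ∈ Icc 0 b, h (a + t) = g t := by
  set h : ℝ → X := fun t => if t ≤ a then f t else g (t - a) with hh
  have hl : ∀ t, t ≤ a → h t = f t := fun t ht => if_pos ht
  have hr : ∀ t, a ≤ t → h t = g (t - a) := by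
    intro t ht
    rcases ht.eq_or_lt with rfl | ht
    · rw [hl _ le_rfl, hfg, sub_self]
    · exact if_neg ht.not_ge
  refine ⟨h, ?_, ?_, fun t ht => hl t ht.2, fun t ht => ?_⟩
  · have key : ∀ s ∈ Icc 0 (a + b), ∀ t ∈ Icc 0 (a + b), s ≤ t →
        dist (h s) (h t) ≤ K * dist s t := by
      intro s hs t ht hst
      have e : dist s t = t - s := by rw [dist_comm, Real.dist_eq, abs_of_nonneg (by linarith)]
      rcases le_total t a with hta | hat
      · rw [hl s (hst.trans hta), hl t hta]
        exact hf.dist_le_mul _ ⟨hs.1, hst.trans hta⟩ _ ⟨ht.1, hta⟩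
      rcases le_total s a with hsa | has
      · rw [hl s hsa, hr t hat]
        have h1 := hf.dist_le_mul s ⟨hs.1, hsa⟩ a ⟨ha, le_rfl⟩
        have h2 := hg.dist_le_mul 0 ⟨le_rfl, hb⟩ (t - a) ⟨by linarith, by linarith [ht.2]⟩
        rw [dist_comm s a, Real.dist_eq, abs_of_nonneg (by linarith)] at h1
        rw [dist_comm (0 : ℝ), Real.dist_eq, sub_zero, abs_of_nonneg (by linarith), ← hfg] at h2
        calc dist (f s) (g (t - a)) ≤ K * (a - s) + K * (t - a) :=
              (dist_triangle _ (f a) _).trans (add_le_add h1 h2)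
          _ = K * dist s t := by rw [e]; ring
      · rw [hr s has, hr t hat]
        have := hg.dist_le_mul (s - a) ⟨by linarith, by linarith [hs.2]⟩ (t - a)
          ⟨by linarith, by linarith [ht.2]⟩
        rwa [dist_sub_right] at this
    refine LipschitzOnWith.of_dist_le_mul fun s hs t ht => ?_
    rcases le_total s t with hst | hst
    · exact key s hs t ht hst
    · rw [dist_comm, dist_comm s]
      exact key t ht s hs hst
  · have hadd := eVariationOn.Icc_add_Icc h (s := univ) ha (by linarith : a ≤ a + b) (mem_univ _)
    simp only [univ_inter] at hadd
    rw [← hadd]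
    congr 1
    · exact eVariationOn.congr fun t ht => hl t ht.2
    · have himg : (fun t => t - a) '' Icc a (a + b) = Icc 0 b := by
        rw [image_sub_const_Icc, sub_self, add_sub_cancel_left]
      rw [← himg, ← eVariationOn.comp_eq_of_monotoneOn g (fun t => t - a)
        (fun s _ t _ hst => sub_le_sub_right hst a)]
      exact eVariationOn.congr fun t ht => hr t ht.1
  · rw [hr _ (by linarith [ht.1]), add_sub_cancel_left]

/-- `f` is a curve on `[0, L]`, of unit speed, from `p` to `q` inside `S`. -/
structure IsUnitArc (f : ℝ → X) (L : ℝ) (p q : X) (S : Set X) : Prop where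
  lipschitz : LipschitzOnWith 1 f (Icc 0 L)
  variation : eVariationOn f (Icc 0 L) = ENNReal.ofReal L
  left : f 0 = p
  right : f L = q
  mem : ∀ t ∈ Icc 0 L, f t ∈ S

theorem IsUnitArc.mono {f : ℝ → X} {L : ℝ} {p q : X} {S T : Set X} (h : IsUnitArc f L p q S)
    (hST : S ⊆ T) : IsUnitArc f L p q T :=
  { h with mem := fun t ht => hST (h.mem t ht) }

theorem IsUnitArc.trans {f g : ℝ → X} {L L' : ℝ} {p q r : X} {S : Set X}
    (hf : IsUnitArc f L p q S) (hg : IsUnitArc g L' q r S) (hL : 0 ≤ L) (hL' : 0 ≤ L') :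
    ∃ h, IsUnitArc h (L + L') p r S := by
  obtain ⟨h, h1, h2, h3, h4⟩ := exists_concat hL hL' (hf.right.trans hg.left.symm)
    hf.lipschitz hg.lipschitz
  refine ⟨h, h1, ?_, ?_, ?_, fun t ht => ?_⟩
  · rw [h2, hf.variation, hg.variation, ENNReal.ofReal_add hL hL']
  · rw [h3 ⟨le_rfl, hL⟩, hf.left]
  · rw [h4 L' ⟨hL', le_rfl⟩, hg.right]
  · rcases le_total t L with h | h
    · rw [h3 ⟨ht.1, h⟩]
      exact hf.mem t ⟨ht.1, h⟩
    · have := h4 (t - L) ⟨by linarith, by linarith [ht.2]⟩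
      rw [add_sub_cancel] at this
      rw [this]
      exact hg.mem _ ⟨by linarith, by linarith [ht.2]⟩

theorem IsUnitArc.symm {f : ℝ → X} {L : ℝ} {p q : X} {S : Set X} (hf : IsUnitArc f L p q S) :
    IsUnitArc (fun t => f (L - t)) L q p S := by
  have hmap : MapsTo (fun t => L - t) (Icc 0 L) (Icc 0 L) :=
    fun t ht => ⟨by linarith [ht.2], by linarith [ht.1]⟩
  refine ⟨?_, ?_, by simp [hf.right], by simp [hf.left], fun t ht => hf.mem _ (hmap ht)⟩
  · refine LipschitzOnWith.of_dist_le_mul fun s hs t ht => ?_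
    have := hf.lipschitz.dist_le_mul _ (hmap hs) _ (hmap ht)
    rwa [dist_sub_left] at this
  · have himg : (fun t => L - t) '' Icc 0 L = Icc 0 L := by
      rw [image_const_sub_Icc, sub_self, sub_zero]
    have := eVariationOn.comp_eq_of_antitoneOn f (t := Icc 0 L) (fun t => L - t)
      (fun s _ t _ hst => sub_le_sub_left hst L)
    rw [himg, hf.variation] at this
    exact this

theorem isUnitArc_zero (p : X) {S : Set X} (hp : p ∈ S) : IsUnitArc (fun _ => p) 0 p p S := by
  refine ⟨(LipschitzWith.const p).weaken zero_le_one |>.lipschitzOnWith, ?_, rfl, rfl,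
    fun _ _ => hp⟩
  rw [eVariationOn.subsingleton _ (by simp), ENNReal.ofReal_zero]

/-- The variation over [s,t] is at most K(t - s). What is needed later is the continuity of arc
length, so that it takes all intermediate values. -/
theorem LipschitzWith.variationOnFromTo_univ {K : ℝ≥0} {c : I → X} (hc : LipschitzWith K c) :
    LipschitzWith K (variationOnFromTo c univ 0) := by
  have hle : ∀ s t : I, s ≤ t → eVariationOn c (univ ∩ Icc s t) ≤ ENNReal.ofReal (K * (t - s)) := by
    intro s t hst
    calc eVariationOn c (univ ∩ Icc s t)
        ≤ K * eVariationOn (id : I → I) (univ ∩ Icc s t) :=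
          (hc.lipschitzOnWith (s := univ)).comp_eVariationOn_le (mapsTo_univ _ _)
      _ ≤ K * ENNReal.ofReal (t - s) := by
          gcongr
          exact (MonotoneOn.eVariationOn_eq (f := fun r : I => (r : ℝ)) (fun _ _ _ _ h => h)
            (mem_univ _) (mem_univ _)).le
      _ = ENNReal.ofReal (K * (t - s)) := by
          rw [ENNReal.ofReal_mul K.coe_nonneg, ENNReal.ofReal_coe_nnreal]
  have hbv : LocallyBoundedVariationOn c univ := by
    intro s t _ _
    rcases le_total s t with h | h
    · exact ne_top_of_le_ne_top ENNReal.ofReal_ne_top (hle s t h)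
    · refine ne_top_of_le_ne_top ENNReal.zero_ne_top (le_of_eq (eVariationOn.subsingleton _ ?_))
      exact (subsingleton_Icc_of_ge h).anti inter_subset_right
  have key : ∀ s t : I, s ≤ t →
      dist (variationOnFromTo c univ 0 t) (variationOnFromTo c univ 0 s) ≤ K * dist t s := by
    intro s t hst
    rw [Real.dist_eq, variationOnFromTo.sub_right hbv (mem_univ _) (mem_univ _) (mem_univ _),
      abs_of_nonneg (variationOnFromTo.nonneg_of_le _ _ hst), variationOnFromTo.eq_of_le _ _ hst,
      Subtype.dist_eq, Real.dist_eq, abs_of_nonneg (sub_nonneg.2 (Subtype.coe_le_coe.2 hst))]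
    exact ENNReal.toReal_le_of_le_ofReal (mul_nonneg K.2 (sub_nonneg.2 (Subtype.coe_le_coe.2 hst)))
      (hle s t hst)
  refine LipschitzWith.of_dist_le_mul fun s t => ?_
  rcases le_total s t with h | h
  · rw [dist_comm, dist_comm s]
    exact key s t h
  · exact key t s h

/-- In a length space, two points are joined by unit speed curves of length arbitrarily close to
the distance. All the initial pieces of these curves have unit speed as well. -/
theorem IsLengthDistance.exists_isUnitArc (hX : IsLengthDistance X) (p q : X) {η : ℝ}
    (hη : 0 < η) : ∃ (f : ℝ → X) (ℓ : ℝ), dist p q ≤ ℓ ∧ ℓ < dist p q + η ∧ f ℓ = q ∧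
      ∀ a ∈ Icc 0 ℓ, IsUnitArc f a p (f a) (closedBall p a) := by
  have hlt : ⨅ (c : I → X) (_ : (∃ K : ℝ≥0, LipschitzWith K c) ∧ c 0 = p ∧ c 1 = q),
      curveLength c < ENNReal.ofReal (dist p q + η) := by
    rw [← hX p q, edist_dist]
    exact (ENNReal.ofReal_lt_ofReal_iff (by positivity)).2 (by linarith)
  simp only [iInf_lt_iff] at hlt
  obtain ⟨c, ⟨⟨K, hK⟩, rfl, rfl⟩, hc⟩ := hlt
  have hbv : BoundedVariationOn c univ := (hc.trans ENNReal.ofReal_lt_top).ne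
  have hlbv := hbv.locallyBoundedVariationOn
  set v := variationOnFromTo c univ 0 with hv
  have hv0 : v 0 = 0 := variationOnFromTo.self _ _ _
  have hv1 : v 1 = (curveLength c).toReal := by
    rw [hv, variationOnFromTo.eq_of_le _ _ zero_le_one, curveLength, univ_inter]
    congr 2
    exact eq_univ_of_forall fun t => ⟨t.2.1, t.2.2⟩
  have hmono : Monotone v := fun s t hst =>
    variationOnFromTo.monotoneOn hlbv (mem_univ _) (mem_univ _) (mem_univ _) hst
  -- Arc length sweeps out a whole interval, so the natural parametrization has unit speed on all of
  -- it, not merely on a subset.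
  have himg : v '' univ = Icc 0 (v 1) := by
    refine Subset.antisymm ?_ ?_
    · rintro _ ⟨t, -, rfl⟩
      exact ⟨hv0 ▸ hmono t.2.1, hmono t.2.2⟩
    · rw [image_univ, ← hv0]
      exact intermediate_value_univ 0 1 hK.variationOnFromTo_univ.continuous
  have hspeed := has_unit_speed_naturalParameterization c hlbv (mem_univ (0 : I))
  rw [← hv, himg] at hspeed
  set f := naturalParameterization c univ (0 : I) with hf
  have hf0 : f 0 = c 0 := by
    have := edist_naturalParameterization_eq_zero hlbv (mem_univ (0 : I)) (mem_univ (0 : I))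
    rw [← hf, ← hv, hv0] at this
    exact edist_eq_zero.1 this
  have hf1 : f (v 1) = c 1 := by
    have := edist_naturalParameterization_eq_zero hlbv (mem_univ (0 : I)) (mem_univ (1 : I))
    rw [← hf, ← hv] at this
    exact edist_eq_zero.1 this
  have hvar : ∀ s ∈ Icc 0 (v 1), ∀ t ∈ Icc 0 (v 1),
      eVariationOn f (Icc s t) = ENNReal.ofReal (t - s) := by
    intro s hs t ht
    have := hspeed hs ht
    rwa [inter_eq_self_of_subset_right (Icc_subset_Icc hs.1 ht.2), NNReal.coe_one, one_mul] at this
  have hdist : ∀ s ∈ Icc 0 (v 1), ∀ t ∈ Icc 0 (v 1), s ≤ t → dist (f s) (f t) ≤ t - s := by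
    intro s hs t ht hst
    have := eVariationOn.edist_le f (s := Icc s t) ⟨le_rfl, hst⟩ ⟨hst, le_rfl⟩
    rw [hvar s hs t ht, edist_dist] at this
    exact (ENNReal.ofReal_le_ofReal_iff (by linarith)).1 this
  have hv10 : 0 ≤ v 1 := hv0 ▸ hmono zero_le_one
  have hlip : LipschitzOnWith 1 f (Icc 0 (v 1)) := by
    refine LipschitzOnWith.of_dist_le_mul fun s hs t ht => ?_
    rw [NNReal.coe_one, one_mul]
    rcases le_total s t with h | h
    · rw [dist_comm s, Real.dist_eq, abs_of_nonneg (sub_nonneg.2 h)]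
      exact hdist s hs t ht h
    · rw [dist_comm (f s), Real.dist_eq, abs_of_nonneg (sub_nonneg.2 h)]
      exact hdist t ht s hs h
  refine ⟨f, v 1, ?_, ?_, hf1, fun a ha => ⟨?_, ?_, hf0, rfl, fun t ht => ?_⟩⟩
  · have := hdist 0 ⟨le_rfl, hv10⟩ (v 1) ⟨hv10, le_rfl⟩ hv10
    rwa [hf0, hf1, sub_zero] at this
  · rw [hv1]
    exact (ENNReal.lt_ofReal_iff_toReal_lt hbv).1 hc
  · exact hlip.mono (Icc_subset_Icc_right ha.2)
  · rw [hvar 0 ⟨le_rfl, hv10⟩ a ha, sub_zero]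
  · have := hdist 0 ⟨le_rfl, hv10⟩ t ⟨ht.1, ht.2.trans ha.2⟩ ht.1
    rw [hf0] at this
    exact mem_closedBall'.2 (by linarith [ht.2])

/-- In a nontrivial length space there are arbitrarily long unit speed loops in every ball: one
runs back and forth along a short curve. -/
theorem IsLengthDistance.exists_loop [Nontrivial X] (hX : IsLengthDistance X) (p : X) {η s : ℝ}
    (hη : 0 < η) (hs : 0 ≤ s) : ∃ f : ℝ → X, IsUnitArc f s p p (closedBall p η) := by
  obtain ⟨q, hq⟩ := exists_ne p
  obtain ⟨f, ℓ, hℓ, -, -, hf⟩ := hX.exists_isUnitArc p q one_pos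
  have hℓ0 : 0 < ℓ := (dist_pos.2 hq.symm).trans_le hℓ
  -- With k round trips, each goes out by a = s/(2k); this k makes a short enough to stay on the
  -- curve and in the ball.
  obtain ⟨k, hk⟩ := exists_nat_gt (s / (2 * min ℓ η))
  have hmin : 0 < min ℓ η := lt_min hℓ0 hη
  have hk0 : (0 : ℝ) < k := (by positivity : 0 ≤ s / (2 * min ℓ η)).trans_lt hk
  set a := s / (2 * k) with ha
  have ha0 : 0 ≤ a := by positivity
  have ham : a ≤ min ℓ η := by
    rw [div_lt_iff₀ (by positivity)] at hk
    rw [ha, div_le_iff₀ (by positivity)]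
    linarith
  have hfa := (hf a ⟨ha0, ham.trans (min_le_left _ _)⟩).mono
    (closedBall_subset_closedBall (ham.trans (min_le_right ℓ η)))
  obtain ⟨g, hg⟩ := hfa.trans hfa.symm ha0 ha0
  have hn : ∀ n : ℕ, ∃ h : ℝ → X, IsUnitArc h (n * (a + a)) p p (closedBall p η) := by
    intro n
    induction n with
    | zero => exact ⟨_, by simpa using isUnitArc_zero p (mem_closedBall_self hη.le)⟩
    | succ n ih =>
      obtain ⟨h, hh⟩ := ih
      obtain ⟨h', hh'⟩ := hh.trans hg (by positivity) (by positivity)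
      refine ⟨h', ?_⟩
      rwa [Nat.cast_succ, add_mul, one_mul]
  obtain ⟨h, hh⟩ := hn k
  refine ⟨h, ?_⟩
  rwa [show (k : ℝ) * (a + a) = s by rw [ha]; field_simp; ring] at hh

/-- In a nontrivial length space, two points are joined by unit speed curves of any prescribed
length greater than the distance. -/
theorem IsLengthDistance.exists_isUnitArc_of_lt [Nontrivial X] (hX : IsLengthDistance X)
    {p q : X} {L η : ℝ} (hL : dist p q < L) (hη : 0 < η) :
    ∃ f : ℝ → X, IsUnitArc f L p q (closedBall p (dist p q + η)) := by
  -- The excess of ℓ over the distance is below η, to stay in the ball, and below the available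
  -- surplus, so that a loop at p of length L - ℓ can be inserted first.
  obtain ⟨f, ℓ, hℓ, hℓ', rfl, hf⟩ := hX.exists_isUnitArc p q (lt_min hη (sub_pos.2 hL))
  have hℓL : ℓ ≤ L := by linarith [min_le_right η (L - dist p (f ℓ))]
  have hℓη : ℓ ≤ dist p (f ℓ) + η := by linarith [min_le_left η (L - dist p (f ℓ))]
  have hℓ0 : 0 ≤ ℓ := dist_nonneg.trans hℓ
  obtain ⟨g, hg⟩ := hX.exists_loop p (η := dist p (f ℓ) + η) (s := L - ℓ)
    (add_pos_of_nonneg_of_pos dist_nonneg hη) (by linarith)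
  obtain ⟨h, hh⟩ := hg.trans ((hf ℓ ⟨hℓ0, le_rfl⟩).mono (closedBall_subset_closedBall hℓη))
    (by linarith) hℓ0
  exact ⟨h, by rwa [sub_add_cancel] at hh⟩

/-- A version of `IsLengthDistance.exists_isUnitArc_of_lt` with curves of constant speed
parametrized by `[0, 1]`. -/
theorem IsLengthDistance.exists_constantSpeed [Nontrivial X] (hX : IsLengthDistance X)
    {p q : X} {L η : ℝ} (hL : dist p q < L) (hη : 0 < η) :
    ∃ f : ℝ → X, LipschitzOnWith L.toNNReal f (Icc 0 1) ∧
      eVariationOn f (Icc 0 1) = ENNReal.ofReal L ∧ f 0 = p ∧ f 1 = q ∧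
      ∀ t ∈ Icc (0 : ℝ) 1, dist (f t) p ≤ dist p q + η := by
  obtain ⟨f, hf⟩ := hX.exists_isUnitArc_of_lt hL hη
  have hL0 : 0 < L := dist_nonneg.trans_lt hL
  have hmap : MapsTo (fun t => L * t) (Icc 0 1) (Icc 0 L) :=
    fun t ht => ⟨mul_nonneg hL0.le ht.1, mul_le_of_le_one_right hL0.le ht.2⟩
  have himg : (fun t => L * t) '' Icc 0 1 = Icc 0 L := by
    rw [image_mul_left_Icc hL0.le zero_le_one, mul_zero, mul_one]
  refine ⟨fun t => f (L * t), ?_, ?_, by simp [hf.left], by simp [hf.right],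
    fun t ht => hf.mem _ (hmap ht)⟩
  · refine LipschitzOnWith.of_dist_le_mul fun s hs t ht => ?_
    have := hf.lipschitz.dist_le_mul _ (hmap hs) _ (hmap ht)
    rw [NNReal.coe_one, one_mul, Real.dist_eq, ← mul_sub, abs_mul, abs_of_pos hL0,
      ← Real.dist_eq] at this
    rwa [Real.coe_toNNReal L hL0.le]
  · have := eVariationOn.comp_eq_of_monotoneOn f (t := Icc 0 1) (fun t => L * t)
      (fun s _ t _ hst => mul_le_mul_of_nonneg_left hst hL0.le)
    rw [himg, hf.variation] at this
    exact this

/-- Concatenation of `N` curves, each of them parametrized by an interval of length one. -/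
theorem exists_concat_range {K : ℝ≥0} {p : ℕ → X} {L : ℕ → ℝ} {P : ℕ → Set X} {N : ℕ}
    (hf : ∀ i < N, ∃ f : ℝ → X, LipschitzOnWith K f (Icc 0 1) ∧
      eVariationOn f (Icc 0 1) = ENNReal.ofReal (L i) ∧ f 0 = p i ∧ f 1 = p (i + 1) ∧
      ∀ t ∈ Icc (0 : ℝ) 1, f t ∈ P i) :
    ∃ g : ℝ → X, LipschitzOnWith K g (Icc 0 N) ∧
      eVariationOn g (Icc 0 N) = ∑ i ∈ Finset.range N, ENNReal.ofReal (L i) ∧ g N = p N ∧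
      ∀ i < N, ∀ t ∈ Icc (i : ℝ) (i + 1), g t ∈ P i := by
  induction N with
  | zero =>
    refine ⟨fun _ => p 0, (LipschitzWith.const _).weaken zero_le |>.lipschitzOnWith, ?_, rfl,
      by simp⟩
    rw [eVariationOn.subsingleton _ (by simp), Finset.sum_range_zero]
  | succ N ih =>
    obtain ⟨g, hg1, hg2, hg3, hg4⟩ := ih fun i hi => hf i (hi.trans N.lt_succ_self)
    obtain ⟨f, hf1, hf2, hf3, hf4, hf5⟩ := hf N N.lt_succ_self
    obtain ⟨h, h1, h2, h3, h4⟩ := exists_concat N.cast_nonneg zero_le_one (hg3.trans hf3.symm)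
      hg1 hf1
    rw [← Nat.cast_succ] at h1 h2
    refine ⟨h, h1, ?_, ?_, fun i hi t ht => ?_⟩
    · rw [h2, hg2, hf2, Finset.sum_range_succ]
    · rw [Nat.cast_succ, h4 1 ⟨zero_le_one, le_rfl⟩, hf4]
    · rcases (Nat.lt_succ_iff.1 hi).eq_or_lt with rfl | hi
      · have := h4 (t - i) ⟨by linarith [ht.1], by linarith [ht.2]⟩
        rw [add_sub_cancel] at this
        rw [this]
        exact hf5 _ ⟨by linarith [ht.1], by linarith [ht.2]⟩
      · have hiN : (i : ℝ) + 1 ≤ N := by exact_mod_cast hi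
        rw [h3 ⟨i.cast_nonneg.trans ht.1, ht.2.trans hiN⟩]
        exact hg4 i hi t ht

end Arcs

/-! ### Pulling small connected sets back through the dilatations -/

namespace DilatationField

variable {X : Type*} [MetricSpace X] {D : DilatationField X}

theorem locallyCompactSpace_of_isCompact_closedBall (hcpt : ∀ x : X, IsCompact (closedBall x 3)) :
    LocallyCompactSpace X :=
  have : WeaklyLocallyCompactSpace X :=
    ⟨fun x => ⟨closedBall x 3, hcpt x, closedBall_mem_nhds x (by norm_num)⟩⟩
  inferInstance

/-- Off the diagonal the tangent distance is positive, and by joint convergence half of it bounds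
the rescaled distances from below near the given pair at all small scales. Compactness makes the
bound uniform. -/
theorem exists_pos_lt_rescaledDist (hcpt : ∀ x : X, IsCompact (closedBall x 3)) {A : ℝ}
    (hA : 0 < A) (hU : D.IsHomeoField) (h1 : D.AxiomA1) (h2 : D.AxiomA2) (h3 : D.AxiomA3 A)
    {x : X} {Q : Set (X × X)} (hQ : IsCompact Q)
    (hQU : ∀ q ∈ Q, q.1 ∈ D.U x ∧ q.2 ∈ D.U x ∧ q.1 ≠ q.2) :
    ∃ m > 0, ∀ᶠ ε in 𝓝[>] (0 : ℝ), ∀ q ∈ Q, m < D.rescaledDist (ε, x, q) := by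
  have key : ∃ m > 0, ∀ᶠ ε in 𝓝[>] (0 : ℝ), ∀ q ∈ Q,
      q.1 ∈ D.U x → q.2 ∈ D.U x → m < D.rescaledDist (ε, x, q) := by
    refine hQ.induction_on (p := fun Q => ∃ m > 0, ∀ᶠ ε in 𝓝[>] (0 : ℝ), ∀ q ∈ Q,
      q.1 ∈ D.U x → q.2 ∈ D.U x → m < D.rescaledDist (ε, x, q)) ?_ ?_ ?_ ?_
    · exact ⟨1, one_pos, by simp⟩
    · rintro s t hst ⟨m, hm, h⟩
      exact ⟨m, hm, h.mono fun ε hε q hq => hε q (hst hq)⟩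
    · rintro s t ⟨m, hm, h⟩ ⟨m', hm', h'⟩
      refine ⟨min m m', lt_min hm hm', ?_⟩
      filter_upwards [h, h'] with ε hε hε' q hq hq1 hq2
      rcases hq with hq | hq
      · exact (min_le_left _ _).trans_lt (hε q hq hq1 hq2)
      · exact (min_le_right _ _).trans_lt (hε' q hq hq1 hq2)
    · rintro ⟨u, v⟩ hq
      obtain ⟨hu, hv, huv⟩ := hQU _ hq
      have hpos := tangentDist_pos hcpt hA hU h1 h2 h3 hu hv huv
      have hev := eventually_nhdsWithin_iff.1 ((tendsto_rescaledDist hcpt hA h1 h2 h3 hu hv).eventually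
        (lt_mem_nhds (half_lt_self hpos)))
      have hev' : ∀ᶠ p : ℝ × X × X in 𝓝 0 ×ˢ 𝓝 (u, v), (p.1, x, p.2) ∈ D.rescaledDom →
          D.tangentDist x u v / 2 < D.rescaledDist (p.1, x, p.2) := by
        rw [← nhds_prod_eq]
        exact (Continuous.tendsto' (f := fun p : ℝ × X × X => (p.1, x, p.2)) (by fun_prop)
          (0, u, v) _ rfl).eventually hev
      obtain ⟨pa, hpa, pb, hpb, h⟩ := eventually_prod_iff.1 hev'
      refine ⟨{q | pb q}, mem_nhdsWithin_of_mem_nhds hpb, _, half_pos hpos, ?_⟩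
      filter_upwards [nhdsWithin_le_nhds hpa, self_mem_nhdsWithin] with ε hε hε0 q hq hq1 hq2
      exact h hε hq ⟨hε0, hq1, hq2⟩
  obtain ⟨m, hm, h⟩ := key
  exact ⟨m, hm, h.mono fun ε hε q hq => hε q hq (hQU q hq).1 (hQU q hq).2.1⟩

/-- Connected sets through `δ_ε^x u` whose size is small compared to `ε` are images under `δ_ε^x` of
sets close to `u`, uniformly for `u` in a compact subset of `U x`. -/
theorem exists_pos_subset_image (hcpt : ∀ x : X, IsCompact (closedBall x 3)) {A : ℝ}
    (hA : 0 < A) (hU : D.IsHomeoField) (h1 : D.AxiomA1) (h2 : D.AxiomA2) (h3 : D.AxiomA3 A)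
    {x : X} {C : Set X} (hC : IsCompact C) (hCU : C ⊆ D.U x) {ρ : ℝ} (hρ : 0 < ρ) :
    ∃ m > 0, ∀ᶠ ε in 𝓝[>] (0 : ℝ), ∀ u ∈ C, ∀ Z : Set X, IsPreconnected Z → D.δ ε x u ∈ Z →
      (∀ z ∈ Z, dist z (D.δ ε x u) < ε * m) → Z ⊆ D.δ ε x '' (ball u ρ ∩ D.U x) := by
  have := locallyCompactSpace_of_isCompact_closedBall hcpt
  obtain ⟨ρ₁, hρ₁, hρ₁U⟩ := hC.exists_cthickening_subset_open (hU.isOpen_U x).1 hCU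
  obtain ⟨ρ₂, hρ₂, hρ₂c⟩ := hC.exists_isCompact_cthickening
  set r := min ρ (min ρ₁ ρ₂) with hr
  have hr0 : 0 < r := by positivity
  have hrU : cthickening r C ⊆ D.U x :=
    (cthickening_mono ((min_le_right _ _).trans (min_le_left _ _)) C).trans hρ₁U
  have hrc : IsCompact (cthickening r C) := hρ₂c.of_isClosed_subset isClosed_cthickening
    (cthickening_mono ((min_le_right _ _).trans (min_le_right _ _)) C)
  have hball : ∀ u ∈ C, closedBall u r ⊆ cthickening r C := fun u hu =>
    closedBall_subset_cthickening hu r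
  -- These are the pairs of a centre in C and a point of its sphere of radius r; the lower bound m
  -- for their rescaled distances is the barrier used below.
  have hQ : IsCompact ((C ×ˢ cthickening r C) ∩ {q : X × X | dist q.2 q.1 = r}) :=
    (hC.prod hrc).inter_right (isClosed_eq (by fun_prop) continuous_const)
  obtain ⟨m, hm, hev⟩ := exists_pos_lt_rescaledDist hcpt hA hU h1 h2 h3 (x := x) hQ
    fun q hq => ⟨hCU hq.1.1, hrU hq.1.2, by
      rintro h
      have := hq.2
      rw [mem_ofPred_eq, h, dist_self] at this
      exact hr0.ne this⟩
  refine ⟨m, hm, ?_⟩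
  filter_upwards [hev, Ioo_mem_nhdsGT (zero_lt_one' ℝ)] with ε hε hε1 u hu Z hZ huZ hZm
  have hballU : closedBall u r ⊆ D.U x := (hball u hu).trans hrU
  have hopen : IsOpen (D.δ ε x '' ball u r) :=
    hU.isOpen_image hε1.1 hε1.2.le isOpen_ball (ball_subset_closedBall.trans hballU)
  have hclosed : IsClosed (D.δ ε x '' closedBall u r) :=
    ((hrc.of_isClosed_subset isClosed_closedBall (hball u hu)).image_of_continuousOn
      ((hU.continuousOn hε1.1 hε1.2.le).mono hballU)).isClosed
  -- Z avoids the image of the sphere, so it is covered by the disjoint open sets image of the open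
  -- ball and complement of the image of the closed ball; it meets the first.
  have hsub : Z ⊆ D.δ ε x '' ball u r := by
    refine hZ.subset_left_of_subset_union hopen hclosed.isOpen_compl ?_ ?_
      ⟨_, huZ, u, mem_ball_self hr0, rfl⟩
    · exact disjoint_compl_right_iff_subset.2 (image_mono ball_subset_closedBall)
    · intro z hz
      by_cases hzc : z ∈ D.δ ε x '' closedBall u r
      · obtain ⟨v, hv, rfl⟩ := hzc
        refine Or.inl ⟨v, (mem_closedBall.1 hv).lt_of_ne fun hvr => ?_, rfl⟩
        have h := hε (u, v) ⟨⟨hu, hball u hu hv⟩, hvr⟩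
        rw [rescaledDist, lt_div_iff₀ hε1.1, dist_comm, mul_comm] at h
        exact lt_asymm h (hZm _ hz)
      · exact Or.inr hzc
  refine hsub.trans (image_mono fun v hv => ⟨?_, hballU (ball_subset_closedBall hv)⟩)
  exact ball_subset_ball (min_le_left _ _) hv

theorem tangentDist_nonneg (hcpt : ∀ x : X, IsCompact (closedBall x 3)) {A : ℝ}
    (hA : 0 < A) (h1 : D.AxiomA1) (h2 : D.AxiomA2) (h3 : D.AxiomA3 A) {x u v : X}
    (hu : u ∈ D.U x) (hv : v ∈ D.U x) : 0 ≤ D.tangentDist x u v := by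
  refine ge_of_tendsto ((tendsto_rescaledDist hcpt hA h1 h2 h3 hu hv).comp
    (tendsto_prodMk_rescaledDom hu hv)) ?_
  filter_upwards [self_mem_nhdsWithin] with ε hε
  exact div_nonneg dist_nonneg (le_of_lt hε)

theorem tangentDist_self (hcpt : ∀ x : X, IsCompact (closedBall x 3)) {A : ℝ}
    (hA : 0 < A) (h1 : D.AxiomA1) (h2 : D.AxiomA2) (h3 : D.AxiomA3 A) {x u : X}
    (hu : u ∈ D.U x) : D.tangentDist x u u = 0 := by
  refine tendsto_nhds_unique ((tendsto_rescaledDist hcpt hA h1 h2 h3 hu hu).comp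
    (tendsto_prodMk_rescaledDom hu hu)) ?_
  simp [Function.comp_def, rescaledDist]

/-- Upper semicontinuity of d^x: joint convergence bounds the rescaled distance by some m' < m for
all pairs near (u,v) at small scales, and letting the scale tend to 0 with the pair fixed keeps the
bound. -/
theorem eventually_tangentDist_lt (hcpt : ∀ x : X, IsCompact (closedBall x 3)) {A : ℝ}
    (hA : 0 < A) (h1 : D.AxiomA1) (h2 : D.AxiomA2) (h3 : D.AxiomA3 A) {x u v : X}
    (hu : u ∈ D.U x) (hv : v ∈ D.U x) {m : ℝ} (hm : D.tangentDist x u v < m) :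
    ∀ᶠ q in 𝓝 (u, v), q.1 ∈ D.U x → q.2 ∈ D.U x → D.tangentDist x q.1 q.2 < m := by
  obtain ⟨m', hm', hm'm⟩ := exists_between hm
  have hev := eventually_nhdsWithin_iff.1 ((tendsto_rescaledDist hcpt hA h1 h2 h3 hu hv).eventually
    (gt_mem_nhds hm'))
  have hev' : ∀ᶠ p : (X × X) × ℝ in 𝓝 ((u, v), 0), (p.2, x, p.1) ∈ D.rescaledDom →
      D.rescaledDist (p.2, x, p.1) < m' :=
    (Continuous.tendsto' (f := fun p : (X × X) × ℝ => (p.2, x, p.1)) (by fun_prop)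
      ((u, v), 0) _ rfl).eventually hev
  filter_upwards [hev'.curry_nhds] with q hq hq1 hq2
  refine lt_of_le_of_lt (le_of_tendsto ((tendsto_rescaledDist hcpt hA h1 h2 h3 hq1 hq2).comp
    (tendsto_prodMk_rescaledDom hq1 hq2)) ?_) hm'm
  filter_upwards [nhdsWithin_le_nhds hq, self_mem_nhdsWithin] with ε hε hε0
  exact (hε ⟨hε0, hq1, hq2⟩).le

/-- Uniform continuity of the curve for d^x: semicontinuity is applied along the diagonal, where d^x
vanishes and whose neighbourhoods form the uniformity of the compact interval. -/
theorem eventually_uniformity_tangentDist_lt (hcpt : ∀ x : X, IsCompact (closedBall x 3)) {A : ℝ}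
    (hA : 0 < A) (h1 : D.AxiomA1) (h2 : D.AxiomA2) (h3 : D.AxiomA3 A) {x : X} {c : I → X}
    (hc : Continuous c) (hcU : ∀ t, c t ∈ D.U x) {m : ℝ} (hm : 0 < m) :
    ∀ᶠ q : I × I in uniformity I, D.tangentDist x (c q.1) (c q.2) < m := by
  rw [← nhdsSet_diagonal_eq_uniformity, eventually_nhdsSet_iff_forall]
  rintro ⟨s, t⟩ hst
  obtain rfl : s = t := hst
  have := eventually_tangentDist_lt hcpt hA h1 h2 h3 (hcU s) (hcU s) (m := m)
    (by rwa [tangentDist_self hcpt hA h1 h2 h3 (hcU s)])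
  have hcc : Tendsto (fun q : I × I => (c q.1, c q.2)) (𝓝 (s, s)) (𝓝 (c s, c s)) :=
    Continuous.tendsto' (by fun_prop) _ _ rfl
  filter_upwards [hcc.eventually this] with q hq using hq (hcU _) (hcU _)

end DilatationField

/-! ### Diagonal selection -/

/-- Elements of sets `T n` with images in any given neighbourhood of `b` for large `n` give a
sequence whose images converge to `b`. -/
theorem exists_seq_mem_tendsto {Y β : Type*} [TopologicalSpace β] [FirstCountableTopology β]
    {T : ℕ → Set Y} {g : ℕ → Y → β} {b : β} (hne : ∀ n, (T n).Nonempty)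
    (h : ∀ s ∈ 𝓝 b, ∀ᶠ n in atTop, ∃ y ∈ T n, g n y ∈ s) :
    ∃ y : ℕ → Y, (∀ n, y n ∈ T n) ∧ Tendsto (fun n => g n (y n)) atTop (𝓝 b) := by
  obtain ⟨B, hB⟩ := (𝓝 b).exists_antitone_basis
  -- Among the first m + 1 basic neighbourhoods, aim for the smallest one that `T n` reaches; the
  -- basis decreases, so all larger ones are hit too. The diagonal m = n is used.
  have key : ∀ n m : ℕ, ∃ y ∈ T n, ∀ k ≤ m, (∃ y ∈ T n, g n y ∈ B k) → g n y ∈ B k := by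
    intro n m
    induction m with
    | zero =>
      by_cases hex : ∃ y ∈ T n, g n y ∈ B 0
      · obtain ⟨y, hy, hyB⟩ := hex
        exact ⟨y, hy, fun k hk _ => by rwa [Nat.le_zero.1 hk]⟩
      · obtain ⟨y, hy⟩ := hne n
        exact ⟨y, hy, fun k hk h => absurd (Nat.le_zero.1 hk ▸ h) hex⟩
    | succ m ih =>
      by_cases hex : ∃ y ∈ T n, g n y ∈ B (m + 1)
      · obtain ⟨y, hy, hyB⟩ := hex
        exact ⟨y, hy, fun k hk _ => hB.antitone hk hyB⟩
      · obtain ⟨y, hy, hyB⟩ := ih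
        refine ⟨y, hy, fun k hk h => ?_⟩
        rcases Nat.le_succ_iff.1 hk with hk | rfl
        · exact hyB k hk h
        · exact absurd h hex
  choose y hyT hyB using fun n => key n n
  refine ⟨y, hyT, hB.toHasBasis.tendsto_right_iff.2 fun k _ => ?_⟩
  filter_upwards [h (B k) (hB.toHasBasis.mem_of_mem trivial), eventually_ge_atTop k] with n hn hkn
  exact hyB n k hkn hn

/-! ### The Gamma-limit and the lower bound -/

namespace DilatationField

variable {X : Type*} [MetricSpace X] {D : DilatationField X}

/-- The length of a curve with respect to the tangent distance at `x`. -/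
noncomputable def tangentLength (D : DilatationField X) (x : X) (c : I → X) : ℝ≥0∞ :=
  ⨆ p : ℕ × {u : ℕ → I // Monotone u},
    ∑ i ∈ Finset.range p.1, ENNReal.ofReal (D.tangentDist x (c (p.2.1 i)) (c (p.2.1 (i + 1))))

/-- The least Lipschitz constant of a curve with respect to the tangent distance at `x`. -/
noncomputable def tangentLip (D : DilatationField X) (x : X) (c : I → X) : ℝ≥0∞ :=
  ⨆ (s : I) (t : I), ENNReal.ofReal (D.tangentDist x (c s) (c t)) / edist s t

/-- The Gamma-limit of the rescaled length functionals. The second term is due to the bound on the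
Lipschitz constants in the domains of these functionals. -/
noncomputable def limitLength (D : DilatationField X) (p : X × C(I, X)) : ℝ≥0∞ :=
  max (D.tangentLength p.1 p.2) (D.tangentLip p.1 p.2 / 2)

theorem ofReal_rescaledDist {ε : ℝ} (hε : 0 < ε) (x u v : X) :
    ENNReal.ofReal (D.rescaledDist (ε, x, u, v)) =
      ENNReal.ofReal ε⁻¹ * edist (D.δ ε x u) (D.δ ε x v) := by
  rw [edist_dist, ← ENNReal.ofReal_mul (inv_nonneg.2 hε.le), rescaledDist, inv_mul_eq_div]

theorem sum_rescaledDist_le {ε : ℝ} (hε : 0 < ε) (p : X × C(I, X)) (N : ℕ) {u : ℕ → I}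
    (hu : Monotone u) :
    ∑ i ∈ Finset.range N, ENNReal.ofReal (D.rescaledDist (ε, p.1, p.2 (u i), p.2 (u (i + 1)))) ≤
      D.rescaledLength ε p := by
  simp only [ofReal_rescaledDist hε]
  rw [← Finset.mul_sum, rescaledLength]
  gcongr
  refine le_trans (le_of_eq ?_) (eVariationOn.sum_le (f := fun t => D.δ ε p.1 (p.2 t))
    (n := N) hu fun i => mem_univ (u i))
  exact Finset.sum_congr rfl fun i _ => edist_comm _ _

/-- This is where the constraint Lip ≤ 2 · length enters the lower bound: it makes the length
dominate half of every difference quotient. -/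
theorem rescaledDist_le {ε : ℝ} (hε : 0 < ε) {p : X × C(I, X)} (hp : p ∈ D.lengthDomain ε)
    (s t : I) : ENNReal.ofReal (D.rescaledDist (ε, p.1, p.2 s, p.2 t)) ≤
      D.rescaledLength ε p * (2 * edist s t) := by
  obtain ⟨-, K, hK, hK2⟩ := hp
  rw [ofReal_rescaledDist hε, rescaledLength]
  calc ENNReal.ofReal ε⁻¹ * edist (D.δ ε p.1 (p.2 s)) (D.δ ε p.1 (p.2 t))
      ≤ ENNReal.ofReal ε⁻¹ * ((2 * curveLength fun t => D.δ ε p.1 (p.2 t)) * edist s t) := by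
        gcongr
        exact (hK s t).trans (by gcongr)
    _ = _ := by ring

theorem le_liminf_of_tendsto {a b : ℕ → ℝ≥0∞} {l : ℝ≥0∞} (ha : Tendsto a atTop (𝓝 l))
    (hab : ∀ n, a n ≤ b n) : l ≤ liminf b atTop :=
  ha.liminf_eq ▸ liminf_le_liminf (Eventually.of_forall hab)

/-- Each sum and each quotient in the two suprema is the limit of its rescaled analogue along `z n`,
which the rescaled length bounds (up to the factor 2 for quotients). The base points move too, so
joint convergence is essential. -/
theorem limitLength_le_liminf (hcpt : ∀ x : X, IsCompact (closedBall x 3)) {A : ℝ}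
    (hA : 0 < A) (h1 : D.AxiomA1) (h2 : D.AxiomA2) (h3 : D.AxiomA3 A) {ε : ℕ → ℝ}
    (hε : ∀ n, ε n ∈ Ioo (0 : ℝ) 1) (hε0 : Tendsto ε atTop (𝓝 0)) {z : ℕ → X × C(I, X)}
    {z₀ : X × C(I, X)} (hz : ∀ n, z n ∈ D.lengthDomain (ε n)) (hz₀ : ∀ t, z₀.2 t ∈ D.U z₀.1)
    (hlim : Tendsto z atTop (𝓝 z₀)) :
    D.limitLength z₀ ≤ liminf (fun n => D.rescaledLength (ε n) (z n)) atTop := by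
  have hpt : ∀ s t : I, Tendsto
      (fun n => ENNReal.ofReal (D.rescaledDist (ε n, (z n).1, (z n).2 s, (z n).2 t))) atTop
      (𝓝 (ENNReal.ofReal (D.tangentDist z₀.1 (z₀.2 s) (z₀.2 t)))) := by
    intro s t
    have hev : ∀ r : I, Tendsto (fun n => (z n).2 r) atTop (𝓝 (z₀.2 r)) := fun r =>
      (Continuous.tendsto' (by fun_prop) z₀ _ rfl : Tendsto (fun p : X × C(I, X) => p.2 r) _
        (𝓝 (z₀.2 r))).comp hlim
    refine (ENNReal.continuous_ofReal.tendsto _).comp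
      ((tendsto_rescaledDist hcpt hA h1 h2 h3 (hz₀ s) (hz₀ t)).comp (tendsto_nhdsWithin_iff.2
        ⟨hε0.prodMk_nhds (((continuous_fst.tendsto z₀).comp hlim).prodMk_nhds
          ((hev s).prodMk_nhds (hev t))), Eventually.of_forall fun n =>
            ⟨(hε n).1, (hz n).1 s, (hz n).1 t⟩⟩))
  refine max_le (iSup_le fun p => ?_) ?_
  · exact le_liminf_of_tendsto (tendsto_finsetSum _ fun i _ => hpt _ _)
      fun n => sum_rescaledDist_le (hε n).1 (z n) p.1 p.2.2
  · rw [ENNReal.div_le_iff two_ne_zero ENNReal.ofNat_ne_top]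
    refine iSup₂_le fun s t => ?_
    rcases eq_or_ne s t with rfl | hst
    · simp [tangentDist_self hcpt hA h1 h2 h3 (hz₀ s)]
    have he0 : edist s t ≠ 0 := (edist_pos.2 hst).ne'
    have he2 : 2 * edist s t ≠ 0 := mul_ne_zero two_ne_zero he0
    have hetop : edist s t ≠ ⊤ := edist_ne_top s t
    have he2top : 2 * edist s t ≠ ⊤ := ENNReal.mul_ne_top ENNReal.ofNat_ne_top hetop
    have := le_liminf_of_tendsto (ENNReal.Tendsto.div_const (hpt s t) (Or.inr he2))
      fun n => (ENNReal.div_le_iff he2 he2top).2 (rescaledDist_le (hε n).1 (hz n) s t)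
    rw [ENNReal.div_le_iff he2 he2top] at this
    rw [ENNReal.div_le_iff he0 hetop, mul_assoc]
    exact this

/-! ### Recovery sequences -/

/-- The points `i / N` of the unit interval. -/
noncomputable def gridPoint (N i : ℕ) : I := projIcc 0 1 zero_le_one ((i : ℝ) / N)

theorem monotone_gridPoint (N : ℕ) : Monotone (gridPoint N) := fun i j hij =>
  monotone_projIcc _ (by gcongr)

theorem coe_gridPoint {N i : ℕ} (hi : i ≤ N) : (gridPoint N i : ℝ) = i / N := by
  rw [gridPoint, projIcc_of_mem]
  exact ⟨by positivity, div_le_one_of_le₀ (by exact_mod_cast hi) N.cast_nonneg⟩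

theorem edist_gridPoint {N i : ℕ} (hi : i < N) :
    edist (gridPoint N i) (gridPoint N (i + 1)) = ENNReal.ofReal (N : ℝ)⁻¹ := by
  rw [edist_dist, Subtype.dist_eq, coe_gridPoint hi.le, coe_gridPoint hi, dist_comm, Real.dist_eq,
    ← sub_div, Nat.cast_succ, add_sub_cancel_left, one_div, abs_of_nonneg (by positivity)]

theorem sum_tangentDist_le (hcpt : ∀ x : X, IsCompact (closedBall x 3)) {A : ℝ}
    (hA : 0 < A) (h1 : D.AxiomA1) (h2 : D.AxiomA2) (h3 : D.AxiomA3 A) {z : X × C(I, X)}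
    (hz : ∀ t, z.2 t ∈ D.U z.1) (htop : D.limitLength z ≠ ⊤) (N : ℕ) :
    ∑ i ∈ Finset.range N, D.tangentDist z.1 (z.2 (gridPoint N i)) (z.2 (gridPoint N (i + 1))) ≤
      (D.limitLength z).toReal := by
  rw [← ENNReal.ofReal_le_iff_le_toReal htop, ENNReal.ofReal_sum_of_nonneg
    fun i _ => tangentDist_nonneg hcpt hA h1 h2 h3 (hz _) (hz _)]
  exact (le_iSup (fun p : ℕ × {u : ℕ → I // Monotone u} => ∑ i ∈ Finset.range p.1,
    ENNReal.ofReal (D.tangentDist z.1 (z.2 (p.2.1 i)) (z.2 (p.2.1 (i + 1)))))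
    (N, ⟨gridPoint N, monotone_gridPoint N⟩)).trans (le_max_left _ _)

/-- Neighbouring grid points are 1/N apart, so the Lipschitz term of the limit functional bounds
each chord by twice the average share. Without that term the chords might be too long for the
constraint. -/
theorem mul_tangentDist_le {z : X × C(I, X)} (htop : D.limitLength z ≠ ⊤) {N i : ℕ} (hi : i < N) :
    N * D.tangentDist z.1 (z.2 (gridPoint N i)) (z.2 (gridPoint N (i + 1))) ≤
      2 * (D.limitLength z).toReal := by
  have hN : (0 : ℝ) < N := by exact_mod_cast (Nat.zero_le i).trans_lt hi
  have h : D.tangentLip z.1 z.2 ≤ D.limitLength z * 2 :=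
    (ENNReal.div_le_iff two_ne_zero ENNReal.ofNat_ne_top).1 (le_max_right _ _)
  have h' := (le_iSup₂ (f := fun s t : I =>
    ENNReal.ofReal (D.tangentDist z.1 (z.2 s) (z.2 t)) / edist s t)
    (gridPoint N i) (gridPoint N (i + 1))).trans h
  rw [edist_gridPoint hi, ENNReal.div_le_iff (by simpa using hi.ne_bot) ENNReal.ofReal_ne_top,
    ← ENNReal.ofReal_toReal htop, ← ENNReal.ofReal_ofNat 2, ← ENNReal.ofReal_mul (by positivity),
    ← ENNReal.ofReal_mul (by positivity), ENNReal.ofReal_le_ofReal_iff (by positivity),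
    ← div_eq_mul_inv, le_div_iff₀ hN] at h'
  linarith

end DilatationField

/-- Numbers with sum less than `M` can be enlarged to numbers with sum `M`, below twice the
average. -/
theorem exists_lt_sum_eq {N : ℕ} (hN : 0 < N) {a : ℕ → ℝ} {M : ℝ} (hM : 0 < M)
    (hsum : ∑ i ∈ Finset.range N, a i < M) (hmax : ∀ i < N, N * a i < 2 * M) :
    ∃ b : ℕ → ℝ, (∀ i < N, a i < b i) ∧ (∀ i < N, N * b i ≤ 2 * M) ∧
      ∑ i ∈ Finset.range N, b i = M := by
  have hN' : (0 : ℝ) < N := by exact_mod_cast hN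
  set S := ∑ i ∈ Finset.range N, a i with hS
  have hden : 0 < 2 * M - S := by linarith
  -- All terms move the same fraction θ of the way to 2M/N; the sum becomes S + θ(2M - S) = M.
  set θ := (M - S) / (2 * M - S) with hθ
  have hθ0 : 0 < θ := div_pos (by linarith) hden
  have hθ1 : θ ≤ 1 := (div_le_one hden).2 (by linarith)
  have hgap : ∀ i < N, 0 < 2 * M / N - a i := fun i hi => by
    rw [sub_pos, lt_div_iff₀ hN']
    linarith [hmax i hi]
  refine ⟨fun i => a i + θ * (2 * M / N - a i), fun i hi => ?_, fun i hi => ?_, ?_⟩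
  · linarith [mul_pos hθ0 (hgap i hi)]
  · have : a i + θ * (2 * M / N - a i) ≤ 2 * M / N := by
      linarith [mul_le_of_le_one_left (hgap i hi).le hθ1]
    rw [le_div_iff₀ hN'] at this
    linarith
  · rw [Finset.sum_add_distrib, ← Finset.mul_sum, Finset.sum_sub_distrib, ← hS, Finset.sum_const,
      Finset.card_range, nsmul_eq_mul, mul_div_cancel₀ _ hN'.ne', hθ, div_mul_cancel₀ _ hden.ne']
    ring

theorem exists_nat_mem_Icc {N : ℕ} (hN : 0 < N) (t : I) :
    ∃ i < N, (N * t : ℝ) ∈ Icc (i : ℝ) (i + 1) := by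
  have hN' : (0 : ℝ) < N := by exact_mod_cast hN
  have h0 : 0 ≤ (N * t : ℝ) := mul_nonneg hN'.le t.2.1
  rcases t.2.2.lt_or_eq with ht | ht
  · refine ⟨⌊(N * t : ℝ)⌋₊, (Nat.floor_lt h0).2 ?_, Nat.floor_le h0, (Nat.lt_floor_add_one _).le⟩
    exact mul_lt_of_lt_one_right hN' ht
  -- At t = 1 the floor would be N, so the last interval is taken.
  · refine ⟨N - 1, Nat.sub_lt hN one_pos, ?_⟩
    rw [ht, mul_one, Nat.cast_pred hN]
    constructor <;> linarith

theorem LipschitzOnWith.comp_mul_unitInterval {X : Type*} [MetricSpace X] {g : ℝ → X} {K : ℝ≥0}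
    {N : ℕ} (hg : LipschitzOnWith K g (Icc 0 N)) :
    LipschitzWith (K * N) (fun t : I => g (N * t)) := by
  have hmap : ∀ t : I, (N * t : ℝ) ∈ Icc (0 : ℝ) N := fun t =>
    ⟨mul_nonneg N.cast_nonneg t.2.1, mul_le_of_le_one_right N.cast_nonneg t.2.2⟩
  refine LipschitzWith.of_dist_le_mul fun s t => ?_
  have := hg.dist_le_mul _ (hmap s) _ (hmap t)
  rwa [Real.dist_eq, ← mul_sub, abs_mul, Nat.abs_cast, ← mul_assoc, ← Real.dist_eq] at this

theorem curveLength_comp_mul {X : Type*} [MetricSpace X] (g : ℝ → X) (N : ℕ) :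
    curveLength (fun t : I => g (N * t)) = eVariationOn g (Icc 0 N) := by
  have himg : (fun t : I => (N * t : ℝ)) '' univ = Icc 0 (N : ℝ) := by
    have : (fun t : I => (N * t : ℝ)) = (fun t : ℝ => N * t) ∘ Subtype.val := rfl
    rw [this, image_comp, image_univ, Subtype.range_coe,
      image_mul_left_Icc N.cast_nonneg zero_le_one, mul_zero, mul_one]
  rw [← himg]
  exact eVariationOn.comp_eq_of_monotoneOn g (t := univ) (fun t : I => (N * t : ℝ))
    (fun s _ t _ hst => mul_le_mul_of_nonneg_left (Subtype.coe_le_coe.2 hst) N.cast_nonneg)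

namespace DilatationField

variable {X : Type*} [MetricSpace X] {D : DilatationField X}

/-- Construction of a curve in the domain of `l_ε`, close to a given curve and with prescribed
rescaled length: consecutive points of a subdivision are joined by curves of suitable lengths. -/
theorem exists_curve_of_subdivision [Nontrivial X] (hX : IsLengthDistance X) (hD : D.IsHomeoField)
    {ε : ℝ} (hε0 : 0 < ε) (hε1 : ε ≤ 1) {x : X} {c : C(I, X)} {N : ℕ} (hN : 0 < N) {M m η : ℝ}
    (hM : 0 < M) (hη : 0 < η)
    (hsum : ∑ i ∈ Finset.range N,
      D.rescaledDist (ε, x, c (gridPoint N i), c (gridPoint N (i + 1))) < M)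
    (hmax : ∀ i < N,
      N * D.rescaledDist (ε, x, c (gridPoint N i), c (gridPoint N (i + 1))) < 2 * M)
    (hm : ∀ i < N, D.rescaledDist (ε, x, c (gridPoint N i), c (gridPoint N (i + 1))) < m)
    (hosc : ∀ s t : I, dist s t ≤ (N : ℝ)⁻¹ → dist (c s) (c t) < η)
    (hlift : ∀ s : I, ∀ Z : Set X, IsPreconnected Z → D.δ ε x (c s) ∈ Z →
      (∀ z ∈ Z, dist z (D.δ ε x (c s)) < ε * m) → Z ⊆ D.δ ε x '' (ball (c s) η ∩ D.U x)) :
    ∃ c' : C(I, X), (x, c') ∈ D.lengthDomain ε ∧ D.rescaledLength ε (x, c') = ENNReal.ofReal M ∧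
      dist c' c ≤ 2 * η := by
  have hN' : (0 : ℝ) < N := by exact_mod_cast hN
  obtain ⟨b, hab, hbM, hbsum⟩ := exists_lt_sum_eq hN hM hsum hmax
  have ha0 : ∀ u v : X, 0 ≤ D.rescaledDist (ε, x, u, v) := fun u v =>
    div_nonneg dist_nonneg hε0.le
  have hb0 : ∀ i < N, 0 ≤ b i := fun i hi => (ha0 _ _).trans (hab i hi).le
  set p : ℕ → X := fun i => D.δ ε x (c (gridPoint N i)) with hp
  have hpd : ∀ i, dist (p i) (p (i + 1)) =
      ε * D.rescaledDist (ε, x, c (gridPoint N i), c (gridPoint N (i + 1))) := fun i => by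
    rw [rescaledDist, mul_div_cancel₀ _ hε0.ne']
  -- Speed at most 2εM/N on unit intervals becomes 2εM after rescaling [0,N] to [0,1]: exactly twice
  -- the total length εM.
  obtain ⟨g, hgK, hgvar, -, hgP⟩ := exists_concat_range (K := (ε * (2 * M / N)).toNNReal)
    (p := p) (L := fun i => ε * b i) (N := N)
    (P := fun i => D.δ ε x '' (ball (c (gridPoint N i)) η ∩ D.U x)) fun i hi => by
      have hlt : dist (p i) (p (i + 1)) < ε * b i := by
        rw [hpd]
        exact mul_lt_mul_of_pos_left (hab i hi) hε0
      have hlt' : dist (p i) (p (i + 1)) < ε * m := by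
        rw [hpd]
        exact mul_lt_mul_of_pos_left (hm i hi) hε0
      -- However long the arc, its loops can be kept small: half of the gap to εm is allowed as
      -- excursion, so the arc stays in the range of the lifting hypothesis.
      obtain ⟨f, hf1, hf2, hf3, hf4, hf5⟩ :=
        hX.exists_constantSpeed hlt (half_pos (sub_pos.2 hlt'))
      refine ⟨f, hf1.weaken (Real.toNNReal_le_toNNReal ?_), hf2, hf3, hf4, fun t ht => ?_⟩
      · refine mul_le_mul_of_nonneg_left ?_ hε0.le
        rw [le_div_iff₀ hN']
        linarith [hbM i hi]
      · refine hlift (gridPoint N i) (f '' Icc 0 1) (isPreconnected_Icc.image f hf1.continuousOn)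
          ⟨0, ⟨le_rfl, zero_le_one⟩, hf3⟩ ?_ ⟨t, ht, rfl⟩
        rintro _ ⟨s, hs, rfl⟩
        have := hf5 s hs
        simp only [hp] at this hlt' ⊢
        linarith
  have hw : ∀ t : I, ∃ w ∈ D.U x, D.δ ε x w = g (N * t) ∧ dist w (c t) < 2 * η := by
    intro t
    obtain ⟨i, hi, hti⟩ := exists_nat_mem_Icc hN t
    obtain ⟨w, ⟨hwη, hwU⟩, hw⟩ := hgP i hi _ hti
    refine ⟨w, hwU, hw, ?_⟩
    have hgrid : dist (gridPoint N i) t ≤ (N : ℝ)⁻¹ := by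
      rw [Subtype.dist_eq, coe_gridPoint hi.le, dist_comm, Real.dist_eq, abs_of_nonneg,
        sub_le_iff_le_add, ← one_div, ← add_div, le_div_iff₀ hN']
      · linarith [hti.2]
      · rw [sub_nonneg, div_le_iff₀ hN']
        linarith [hti.1]
    have := hosc _ _ hgrid
    have := mem_ball.1 hwη
    linarith [dist_triangle w (c (gridPoint N i)) (c t)]
  have hGlip := hgK.comp_mul_unitInterval
  obtain ⟨e, he⟩ := hD.homeo_le x ε hε0 hε1
  have hV : ∀ t : I, g (N * t) ∈ D.V ε x := fun t => by
    obtain ⟨w, hwU, hw, -⟩ := hw t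
    rw [← hw, ← he ⟨w, hwU⟩]
    exact (e ⟨w, hwU⟩).2
  set c' : C(I, X) := ⟨fun t => (e.symm ⟨g (N * t), hV t⟩ : X), 
    continuous_subtype_val.comp (e.symm.continuous.comp (hGlip.continuous.subtype_mk hV))⟩ with hc'
  have hδc' : ∀ t, D.δ ε x (c' t) = g (N * t) := fun t => by
    rw [hc', ContinuousMap.coe_mk, ← he, e.apply_symm_apply]
  have hlen : curveLength (fun t => D.δ ε x (c' t)) = ENNReal.ofReal (ε * M) := by
    simp only [hδc']
    rw [curveLength_comp_mul, hgvar, ← ENNReal.ofReal_sum_of_nonneg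
      fun i hi => mul_nonneg hε0.le (hb0 i (Finset.mem_range.1 hi)), ← Finset.mul_sum, hbsum]
  refine ⟨c', ⟨fun t => (e.symm ⟨g (N * t), hV t⟩).2,
    (ε * (2 * M / N)).toNNReal * N, ?_, ?_⟩, ?_, ?_⟩
  · simp only [hδc']
    exact hGlip
  · simp only [hlen]
    rw [ENNReal.coe_mul, ENNReal.coe_natCast, ENNReal.ofNNReal_toNNReal, ← ENNReal.ofReal_natCast,
      ← ENNReal.ofReal_mul (by positivity), ← ENNReal.ofReal_ofNat 2,
      ← ENNReal.ofReal_mul (by positivity)]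
    refine ENNReal.ofReal_le_ofReal (le_of_eq ?_)
    field_simp
  · simp only [rescaledLength, hlen]
    rw [← ENNReal.ofReal_mul (by positivity), inv_mul_cancel_left₀ hε0.ne']
  · refine (ContinuousMap.dist_le (by positivity)).2 fun t => ?_
    obtain ⟨w, hwU, hw, hwη⟩ := hw t
    have : c' t = w := hD.injOn hε0 hε1 (e.symm ⟨g (N * t), hV t⟩).2 hwU ((hδc' t).trans hw.symm)
    rw [this]
    exact hwη.le

/-- M is taken slightly above a finite limit value, or very large when the value is infinite. The
strict inequalities survive the passage from d^x to rescaled distances at small scales. -/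
theorem exists_pos_ofReal_mem (hcpt : ∀ x : X, IsCompact (closedBall x 3)) {A : ℝ}
    (hA : 0 < A) (h1 : D.AxiomA1) (h2 : D.AxiomA2) (h3 : D.AxiomA3 A) {z : X × C(I, X)}
    (hz : ∀ t, z.2 t ∈ D.U z.1) {s : Set ℝ≥0∞} (hs : s ∈ 𝓝 (D.limitLength z)) (N : ℕ) :
    ∃ M : ℝ, 0 < M ∧ ENNReal.ofReal M ∈ s ∧
      ∑ i ∈ Finset.range N, D.tangentDist z.1 (z.2 (gridPoint N i)) (z.2 (gridPoint N (i + 1))) < M ∧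
      ∀ i < N, N * D.tangentDist z.1 (z.2 (gridPoint N i)) (z.2 (gridPoint N (i + 1))) < 2 * M := by
  by_cases htop : D.limitLength z = ⊤
  · rw [htop] at hs
    have hmax : ∀ᶠ M : ℝ in atTop, ∀ i ∈ Finset.range N,
        N * D.tangentDist z.1 (z.2 (gridPoint N i)) (z.2 (gridPoint N (i + 1))) < 2 * M := by
      rw [Filter.eventually_all_finset]
      exact fun i _ => (tendsto_id.const_mul_atTop two_pos).eventually_gt_atTop _
    obtain ⟨M, hM0, hMs, hMsum, hMmax⟩ := ((eventually_gt_atTop (0 : ℝ)).and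
      ((ENNReal.tendsto_ofReal_atTop.eventually hs).and
        ((eventually_gt_atTop (∑ i ∈ Finset.range N,
          D.tangentDist z.1 (z.2 (gridPoint N i)) (z.2 (gridPoint N (i + 1))))).and hmax))).exists
    exact ⟨M, hM0, hMs, hMsum, fun i hi => hMmax i (Finset.mem_range.2 hi)⟩
  · rw [← ENNReal.ofReal_toReal htop] at hs
    have hnhds : ∀ᶠ M in 𝓝[>] (D.limitLength z).toReal, ENNReal.ofReal M ∈ s :=
      nhdsWithin_le_nhds ((ENNReal.continuous_ofReal.tendsto _).eventually hs)
    obtain ⟨M, hMs, hM⟩ := (hnhds.and self_mem_nhdsWithin).exists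
    exact ⟨M, ENNReal.toReal_nonneg.trans_lt hM, hMs,
      (sum_tangentDist_le hcpt hA h1 h2 h3 hz htop N).trans_lt hM,
      fun i hi => (mul_tangentDist_le htop hi).trans_lt (by linarith)⟩

/-- The order of choices matters: the closeness η gives the lifting bound m, then N makes
neighbouring points η-close and at tangent distance below m, then M is chosen for this N, and ε
comes last. Only finitely many pairs of points then have to be controlled. -/
theorem eventually_exists_mem_lengthDomain [Nontrivial X] (hX : IsLengthDistance X)
    (hcpt : ∀ x : X, IsCompact (closedBall x 3)) {A : ℝ} (hA : 0 < A) (hD : D.IsHomeoField)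
    (h1 : D.AxiomA1) (h2 : D.AxiomA2) (h3 : D.AxiomA3 A) {z : X × C(I, X)}
    (hz : ∀ t, z.2 t ∈ D.U z.1) {s : Set ((X × C(I, X)) × ℝ≥0∞)}
    (hs : s ∈ 𝓝 (z, D.limitLength z)) :
    ∀ᶠ ε in 𝓝[>] (0 : ℝ), ∃ z' ∈ D.lengthDomain ε, (z', D.rescaledLength ε z') ∈ s := by
  obtain ⟨s₁, hs₁, s₂, hs₂, hss⟩ := mem_nhds_prod_iff.1 hs
  obtain ⟨η₀, hη₀, hηs⟩ := Metric.mem_nhds_iff.1 hs₁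
  set η := η₀ / 3 with hη
  have hη0 : 0 < η := by positivity
  have hC : IsCompact (range z.2) := isCompact_range z.2.continuous
  have hCU : range z.2 ⊆ D.U z.1 := range_subset_iff.2 hz
  obtain ⟨m, hm, hlift⟩ := exists_pos_subset_image hcpt hA hD h1 h2 h3 hC hCU hη0
  have hunif : ∀ᶠ q : I × I in uniformity I,
      dist (z.2 q.1) (z.2 q.2) < η ∧ D.tangentDist z.1 (z.2 q.1) (z.2 q.2) < m :=
    ((CompactSpace.uniformContinuous_of_continuous z.2.continuous).eventually
      (dist_mem_uniformity hη0)).and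
      (eventually_uniformity_tangentDist_lt hcpt hA h1 h2 h3 z.2.continuous hz hm)
  obtain ⟨κ, hκ, hκI⟩ := Metric.mem_uniformity_dist.1 hunif
  obtain ⟨n, hn⟩ := exists_nat_one_div_lt hκ
  set N := n + 1 with hNn
  have hN : 0 < N := n.succ_pos
  have hNκ : (N : ℝ)⁻¹ < κ := by rwa [hNn, Nat.cast_succ, ← one_div]
  obtain ⟨M, hM0, hMs, hMsum, hMmax⟩ := exists_pos_ofReal_mem hcpt hA h1 h2 h3 hz hs₂ N
  have hlim : ∀ i, Tendsto
      (fun ε => D.rescaledDist (ε, z.1, z.2 (gridPoint N i), z.2 (gridPoint N (i + 1))))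
      (𝓝[>] 0) (𝓝 (D.tangentDist z.1 (z.2 (gridPoint N i)) (z.2 (gridPoint N (i + 1))))) :=
    fun i => (tendsto_rescaledDist hcpt hA h1 h2 h3 (hz _) (hz _)).comp
      (tendsto_prodMk_rescaledDom (hz _) (hz _))
  have hev : ∀ᶠ ε in 𝓝[>] (0 : ℝ), ∀ i ∈ Finset.range N,
      N * D.rescaledDist (ε, z.1, z.2 (gridPoint N i), z.2 (gridPoint N (i + 1))) < 2 * M ∧
      D.rescaledDist (ε, z.1, z.2 (gridPoint N i), z.2 (gridPoint N (i + 1))) < m := by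
    rw [Filter.eventually_all_finset]
    intro i hi
    rw [Finset.mem_range] at hi
    have hd : dist (gridPoint N i) (gridPoint N (i + 1)) < κ := by
      rw [dist_edist, edist_gridPoint hi, ENNReal.toReal_ofReal (by positivity)]
      exact hNκ
    exact (((hlim i).const_mul _).eventually (gt_mem_nhds (hMmax i hi))).and
      ((hlim i).eventually (gt_mem_nhds (hκI hd).2))
  filter_upwards [hev, (tendsto_finsetSum (Finset.range N) fun i _ => hlim i).eventually
    (gt_mem_nhds hMsum), hlift, Ioo_mem_nhdsGT (zero_lt_one' ℝ)] with ε hε hεsum hεlift hε1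
  obtain ⟨c', hc', hlen, hdist⟩ := exists_curve_of_subdivision hX hD hε1.1 hε1.2.le hN hM0 hη0
    hεsum (fun i hi => (hε i (Finset.mem_range.2 hi)).1)
    (fun i hi => (hε i (Finset.mem_range.2 hi)).2)
    (fun s t hst => (hκI (hst.trans_lt hNκ)).1) (fun s => hεlift _ (mem_range_self s))
  refine ⟨(z.1, c'), hc', hss ⟨hηs ?_, by rwa [hlen]⟩⟩
  rw [mem_ball, Prod.dist_eq, dist_self, max_lt_iff]
  exact ⟨hη₀, hdist.trans_lt (by linarith)⟩

theorem const_mem_lengthDomain (hD : D.IsHomeoField) (ε : ℝ) (x : X) :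
    (x, ContinuousMap.const I x) ∈ D.lengthDomain ε :=
  ⟨fun _ => (hD.isOpen_U x).2, 0, LipschitzWith.const (D.δ ε x x), by simp⟩

/-- Axiom A3L holds: the rescaled length functionals Gamma-converge. -/
theorem axiomA3L_of_isLengthDistance (hX : IsLengthDistance X)
    (hcpt : ∀ x : X, IsCompact (closedBall x 3)) {A : ℝ} (hA : 0 < A) (hD : D.IsHomeoField)
    (h1 : D.AxiomA1) (h2 : D.AxiomA2) (h3 : D.AxiomA3 A) : D.AxiomA3L := by
  refine ⟨D.limitLength, fun ε hε hε0 => ⟨fun z z₀ hz hz₀ hlim =>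
    limitLength_le_liminf hcpt hA h1 h2 h3 hε hε0 hz hz₀.1 hlim, fun z₀ hz₀ => ?_⟩⟩
  have hεw : Tendsto ε atTop (𝓝[>] 0) :=
    tendsto_nhdsWithin_iff.2 ⟨hε0, Eventually.of_forall fun n => (hε n).1⟩
  -- A one-point space has no loops to spend length in; there all lengths vanish, and the lower
  -- bound forces the limit to vanish too.
  rcases subsingleton_or_nontrivial X with hsub | hnt
  · have hmem : ∀ n, z₀ ∈ D.lengthDomain (ε n) := fun n => by
      have := const_mem_lengthDomain hD (ε n) z₀.1
      rwa [show (z₀.1, ContinuousMap.const I z₀.1) = z₀ from Subsingleton.elim _ _] at this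
    have hzero : ∀ n, D.rescaledLength (ε n) z₀ = 0 := fun n => by
      rw [rescaledLength, curveLength, eVariationOn.constant_on (subsingleton_of_subsingleton),
        mul_zero]
    have hle := limitLength_le_liminf hcpt hA h1 h2 h3 hε hε0 hmem hz₀.1 tendsto_const_nhds
    simp only [hzero, liminf_const, nonpos_iff_eq_zero] at hle
    refine ⟨fun _ => z₀, hmem, tendsto_const_nhds, ?_⟩
    simp only [hzero, hle]
    exact tendsto_const_nhds
  · obtain ⟨z, hz, hlim⟩ := exists_seq_mem_tendsto (T := fun n => D.lengthDomain (ε n))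
      (g := fun n z => (z, D.rescaledLength (ε n) z))
      (fun n => ⟨_, const_mem_lengthDomain hD (ε n) z₀.1⟩)
      fun s hs => hεw.eventually
        (eventually_exists_mem_lengthDomain hX hcpt hA hD h1 h2 h3 hz₀.1 hs)
    exact ⟨z, hz, (continuous_fst.tendsto _).comp hlim, (continuous_snd.tendsto _).comp hlim⟩

end DilatationField

theorem corollary8p4 {Ω : Type*} [MetricSpace Ω] (D : DilatationField Ω)
    (hstrong : D.IsStrongDilatationStructure) (htempered : D.IsTempered)
    (hRN : D.HasRadonNikodymProperty) :
    D.IsLengthDilatationStructure := by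
  obtain ⟨hcomplete, hcpt, ⟨A, B, h0, h3⟩, h1, h2, h4⟩ := hstrong
  have hA : 0 < A := zero_lt_one.trans h0.one_lt_A
  exact ⟨hcomplete, DilatationField.locallyCompactSpace_of_isCompact_closedBall hcpt,
    ⟨A, B, h0⟩, h1, h2,
    DilatationField.axiomA3L_of_isLengthDistance htempered.1 hcpt hA h0.homeoField h1 h2 h3, h4,
    h4.sumConverges hcpt h0.one_lt_A h0.homeoField h1 h2 h3.closedBall_subset_U⟩
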